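/- Let $\mathbb{K}$ be a field of characteristic zero, $R$ a commutative unital $\mathbb{K}$-algebra, $\mathfrak{h}=\mathbb{K}\langle x,y\rangle$ the algebra of noncommutative polynomials, $\mathfrak{h}^1=\mathbb{K}+\mathfrak{h}y$, $\mathfrak{h}^0=\mathbb{K}+x\mathfrak{h}y$, and $z_k=x^{k-1}y$ for $k\geq 1$. The shuffle product $\sqcup\!\sqcup$ on $\mathfrak{h}$ and the stuffle product $\ast$ on $\mathfrak{h}^1$ are the $\mathbb{K}$-bilinear products with unit $1$ such that, for letters $a,b$ and words $u,v$, $au\sqcup\!\sqcup bv=a(u\sqcup\!\sqcup bv)+b(au\sqcup\!\sqcup v)$, and, for $k,l\geq 1$ and words $u,v\in\mathfrak{h}^1$, $z_ku\ast z_lv=z_k(u\ast z_lv)+z_l(z_ku\ast v)+z_{k+l}(u\ast v)$. Both products make $\mathfrak{h}^1$ a polynomial algebra in $y$ over its subalgebra $\mathfrak{h}^0$. For a $\mathbb{K}$-linear map $Z_R:\mathfrak{h}^0\to R$ put $\zeta_R(k_1,\dots,k_n)=Z_R(z_{k_1}\cdots z_{k_n})$ for integers $k_1\geq 2$, $k_2,\dots,k_n\geq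 1$. The map $Z_R$ satisfies the regularized double shuffle relations if $Z_R(1)=1$, $Z_R(u\sqcup\!\sqcup v)=Z_R(u)Z_R(v)=Z_R(u\ast v)$ for all $u,v\in\mathfrak{h}^0$, and $Z_R^{\sqcup\!\sqcup}=\rho_R\circ Z_R^{\ast}$ on $\mathfrak{h}^1$. Here $Z_R^{\sqcup\!\sqcup},Z_R^{\ast}:\mathfrak{h}^1\to R[T]$ are the extensions of $Z_R$ to algebra homomorphisms for $\sqcup\!\sqcup$ and $\ast$, respectively, with $y\mapsto T$, and $\rho_R$ is the $R$-linear endomorphism of $R[T]$ with $\rho_R(e^{Tu})=\exp\left(\sum_{m\geq 2}\frac{(-1)^m}{m}\zeta_R(m)u^m\right)e^{Tu}$. **Theorem.** Let $Z_R:\mathfrak{h}^0\to R$ satisfy the regularized double shuffle relations, let $k\geq n\geq 1$ be integers, and let $\lambda$ be an element of a commutative $R$-algebra with $\lambda^2=-24\zeta_R(2)$. Then $$\sum_{\substack{k_1+\cdots+k_n=k\\ k_i\geq 1}}\zeta_R(2k_1,\dots,2k_n)=\sum_{j=0}^{\lfloor (n-1)/2\rfloor}\frac{\lambda^{2j}}{2^{2n-2}(2j+1)!}\binom{2n-2j-1}{n}\zeta_R(2k-2j)$$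 (as an identity in that algebra), and, as an identity in $R$, the left-hand side also equals $$\frac{1}{2^{2n-2}}\binom{2n-1}{n}\zeta_R(2k)-\sum_{j=1}^{\lfloor (n-1)/2\rfloor}\frac{\binom{2n-2j-1}{n}}{2^{2n-3}(2j+1)B_{2j}}\zeta_R(2j)\zeta_R(2k-2j),$$ where the Bernoulli numbers are given by $\frac{t}{e^t-1}=\sum_{m\geq 0}\frac{B_m}{m!}t^m$. -/

import Mathlib

noncomputable section

namespace DoubleShuffle

/-- The alphabet `{x, y}`. -/
inductive Letter : Type
  | x : Letter
  | y : Letter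

/-- The algebra `𝔥 = K⟨x, y⟩` of noncommutative polynomials. -/
abbrev H (K : Type*) [Field K] : Type _ := MonoidAlgebra K (FreeMonoid Letter)

section Algebra

variable (K : Type*) [Field K]

/-- A word in the letters `x, y`, as an element of `𝔥`. -/
def word (w : List Letter) : H K := MonoidAlgebra.single (FreeMonoid.ofList w) 1

/-- The noncommutative variable `x`. -/
def X : H K := word K [Letter.x]

/-- The noncommutative variable `y`. -/
def Y : H K := word K [Letter.y]

/-- `z_k = x^{k-1} y`, for `k ≥ 1`. -/
def z (k : ℕ) : H K := X K ^ (k - 1) * Y K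

/-- `z_{k_1} ⋯ z_{k_n}`. -/
def zWord (ks : List ℕ) : H K := (ks.map (z K)).prod

/-- `𝔥¹ = K + 𝔥 y`. -/
def h1 : Submodule K (H K) :=
  Submodule.span K {1} ⊔ LinearMap.range (LinearMap.mulRight K (Y K))

/-- `𝔥⁰ = K + x 𝔥 y`. -/
def h0 : Submodule K (H K) :=
  Submodule.span K {1} ⊔
    LinearMap.range (LinearMap.mulLeft K (X K) ∘ₗ LinearMap.mulRight K (Y K))

/-- The bilinear operation on `𝔥` with prescribed values on pairs of words. -/
def bilinOfWords (f : List Letter → List Letter → H K) : H K →ₗ[K] H K →ₗ[K] H K :=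
  (MonoidAlgebra.basis (FreeMonoid Letter) K).constr K fun u =>
    (MonoidAlgebra.basis (FreeMonoid Letter) K).constr K fun v => f u.toList v.toList

/-- The shuffle product of two words:
`w ⧢ 1 = 1 ⧢ w = w` and `au ⧢ bv = a (u ⧢ bv) + b (au ⧢ v)` for letters `a, b`. -/
def shuffleWord : List Letter → List Letter → H K
  | [], v => word K v
  | a :: u, [] => word K (a :: u)
  | a :: u, b :: v =>
      word K [a] * shuffleWord u (b :: v) + word K [b] * shuffleWord (a :: u) v
termination_by u v => u.length + v.length

/-- The shuffle product on `𝔥`. -/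
def shuffle : H K →ₗ[K] H K →ₗ[K] H K := bilinOfWords K (shuffleWord K)

/-- The stuffle product of `z_{k_1} ⋯ z_{k_n}` and `z_{l_1} ⋯ z_{l_m}`:
`w * 1 = 1 * w = w` and
`z_k u * z_l v = z_k (u * z_l v) + z_l (z_k u * v) + z_{k+l} (u * v)`. -/
def stuffleIdx : List ℕ → List ℕ → H K
  | [], ls => zWord K ls
  | k :: ks, [] => zWord K (k :: ks)
  | k :: ks, l :: ls =>
      z K k * stuffleIdx ks (l :: ls) + z K l * stuffleIdx (k :: ks) ls
        + z K (k + l) * stuffleIdx ks ls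
termination_by ks ls => ks.length + ls.length

end Algebra

/-- Auxiliary to `decode`: `c` letters `x` have been read since the last `y`. -/
def decodeAux : ℕ → List Letter → List ℕ
  | _, [] => []
  | c, Letter.x :: w => decodeAux (c + 1) w
  | c, Letter.y :: w => (c + 1) :: decodeAux 0 w

/-- The index `(k_1, …, k_n)` of the word `z_{k_1} ⋯ z_{k_n}`. (Letters `x` after the last `y`
are dropped; the words of `𝔥¹` have none.) -/
def decode (w : List Letter) : List ℕ := decodeAux 0 w

/-- The index `(k_1, …, k_n)` is admissible: all `k_i ≥ 1`, and `k_1 ≥ 2` unless `n = 0`. -/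
def Admissible (ks : List ℕ) : Prop :=
  (∀ k ∈ ks, 1 ≤ k) ∧ ∀ k ∈ ks.head?, 2 ≤ k

section Products

variable (K : Type*) [Field K]

/-- The stuffle product on `𝔥¹`, as the restriction to `𝔥¹` of a bilinear operation on `𝔥`
(the values outside `𝔥¹` are irrelevant). -/
def stuffle : H K →ₗ[K] H K →ₗ[K] H K :=
  bilinOfWords K fun u v => stuffleIdx K (decode u) (decode v)

lemma word_nil : word K [] = 1 := rfl

lemma word_append (u v : List Letter) : word K (u ++ v) = word K u * word K v := by
  simp [word, MonoidAlgebra.single_mul_single, FreeMonoid.ofList_append]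

lemma word_cons (a : Letter) (v : List Letter) : word K (a :: v) = word K [a] * word K v :=
  word_append K [a] v

lemma bilinOfWords_word (f : List Letter → List Letter → H K) (u v : List Letter) :
    bilinOfWords K f (word K u) (word K v) = f u v := by
  have h : ∀ w : List Letter,
      word K w = MonoidAlgebra.basis (FreeMonoid Letter) K (FreeMonoid.ofList w) := fun w => by
    rw [MonoidAlgebra.basis_apply]; rfl
  simp only [bilinOfWords, h, Module.Basis.constr_basis, FreeMonoid.toList_ofList]

/-- The letters of `z_{k_1} ⋯ z_{k_n}`. -/
def encode (ks : List ℕ) : List Letter :=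
  ks.flatMap fun k => List.replicate (k - 1) Letter.x ++ [Letter.y]

lemma word_replicate_x (n : ℕ) : word K (List.replicate n Letter.x) = X K ^ n := by
  induction n with
  | zero => rfl
  | succ n ih => rw [List.replicate_succ, word_cons, ih, pow_succ']; rfl

lemma zWord_cons (k : ℕ) (ks : List ℕ) : zWord K (k :: ks) = z K k * zWord K ks := by
  simp [zWord]

lemma word_encode (ks : List ℕ) : word K (encode ks) = zWord K ks := by
  induction ks with
  | nil => rfl
  | cons k ks ih =>
    rw [zWord_cons, ← ih, encode, List.flatMap_cons, word_append, word_append, word_replicate_x]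
    rfl

lemma decodeAux_replicate (c n : ℕ) (w : List Letter) :
    decodeAux c (List.replicate n Letter.x ++ Letter.y :: w) = (c + n + 1) :: decodeAux 0 w := by
  induction n generalizing c with
  | zero => simp [decodeAux]
  | succ n ih =>
    rw [List.replicate_succ, List.cons_append, decodeAux, ih]
    congr 1
    omega

lemma decode_encode (ks : List ℕ) (h : ∀ k ∈ ks, 1 ≤ k) : decode (encode ks) = ks := by
  induction ks with
  | nil => rfl
  | cons k ks ih =>
    have h1 := h k (by simp)
    have h2 := ih fun i hi => h i (by simp [hi])
    have h3 : encode (k :: ks) =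
        List.replicate (k - 1) Letter.x ++ Letter.y :: encode ks := by
      simp [encode]
    rw [decode, h3, decodeAux_replicate, ← decode, h2]
    congr 1
    omega

/-- The stuffle product on the basis `z_{k_1} ⋯ z_{k_n}` of `𝔥¹` is the one given by the
recursion. -/
lemma stuffle_zWord (ks ls : List ℕ) (hk : ∀ k ∈ ks, 1 ≤ k) (hl : ∀ l ∈ ls, 1 ≤ l) :
    stuffle K (zWord K ks) (zWord K ls) = stuffleIdx K ks ls := by
  rw [← word_encode, ← word_encode, stuffle, bilinOfWords_word, decode_encode ks hk,
    decode_encode ls hl]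

lemma one_mem_h0 : (1 : H K) ∈ h0 K :=
  Submodule.mem_sup_left (Submodule.mem_span_singleton_self 1)

lemma one_mem_h1 : (1 : H K) ∈ h1 K :=
  Submodule.mem_sup_left (Submodule.mem_span_singleton_self 1)

lemma X_mul_mul_Y_mem_h0 (m : H K) : X K * (m * Y K) ∈ h0 K :=
  Submodule.mem_sup_right ⟨m, rfl⟩

lemma Y_mul_mem (m : H K) (hm : m ∈ h1 K) : ∃ p : H K, Y K * m = p * Y K := by
  obtain ⟨a, ha, b, ⟨c, hc⟩, rfl⟩ := Submodule.mem_sup.1 hm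
  obtain ⟨r, rfl⟩ := Submodule.mem_span_singleton.1 ha
  refine ⟨r • 1 + Y K * c, ?_⟩
  rw [← hc]
  simp [mul_add, add_mul, mul_assoc]

lemma z_mul_mem_h1 (k : ℕ) (m : H K) (hm : m ∈ h1 K) : z K k * m ∈ h1 K := by
  obtain ⟨p, hp⟩ := Y_mul_mem K m hm
  refine Submodule.mem_sup_right ⟨X K ^ (k - 1) * p, ?_⟩
  simp [z, mul_assoc, hp]

lemma z_mul_mem_h0 (k : ℕ) (hk : 2 ≤ k) (m : H K) (hm : m ∈ h1 K) : z K k * m ∈ h0 K := by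
  obtain ⟨p, hp⟩ := Y_mul_mem K m hm
  obtain ⟨j, rfl⟩ : ∃ j, k = j + 2 := ⟨k - 2, by omega⟩
  have h : z K (j + 2) * m = X K * ((X K ^ j * p) * Y K) := by
    rw [z, mul_assoc, hp, show j + 2 - 1 = j + 1 by omega, pow_succ']
    simp only [mul_assoc]
  rw [h]
  exact X_mul_mul_Y_mem_h0 K _

lemma zWord_mem_h1 (ks : List ℕ) : zWord K ks ∈ h1 K := by
  induction ks with
  | nil => exact one_mem_h1 K
  | cons k ks ih => rw [zWord_cons]; exact z_mul_mem_h1 K k _ ih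

lemma zWord_mem_h0 (ks : List ℕ) (h : Admissible ks) : zWord K ks ∈ h0 K := by
  cases ks with
  | nil => exact one_mem_h0 K
  | cons k ks =>
    rw [zWord_cons]
    exact z_mul_mem_h0 K k (h.2 k (by simp)) _ (zWord_mem_h1 K ks)

lemma stuffleIdx_mem_h1 (ks ls : List ℕ) : stuffleIdx K ks ls ∈ h1 K := by
  induction ks, ls using stuffleIdx.induct with
  | case1 ls => rw [stuffleIdx]; exact zWord_mem_h1 K ls
  | case2 k ks => rw [stuffleIdx]; exact zWord_mem_h1 K _
  | case3 k ks l ls ih1 ih2 ih3 =>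
    rw [stuffleIdx]
    exact add_mem (add_mem (z_mul_mem_h1 K _ _ ih1) (z_mul_mem_h1 K _ _ ih2))
      (z_mul_mem_h1 K _ _ ih3)

lemma stuffleIdx_mem_h0 (ks ls : List ℕ) (hk : Admissible ks) (hl : Admissible ls) :
    stuffleIdx K ks ls ∈ h0 K := by
  cases ks with
  | nil => rw [stuffleIdx]; exact zWord_mem_h0 K ls hl
  | cons k ks =>
    cases ls with
    | nil => rw [stuffleIdx]; exact zWord_mem_h0 K _ hk
    | cons l ls =>
      have h1 : 2 ≤ k := hk.2 k (by simp)
      have h2 : 2 ≤ l := hl.2 l (by simp)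
      rw [stuffleIdx]
      exact add_mem (add_mem (z_mul_mem_h0 K _ h1 _ (stuffleIdx_mem_h1 K _ _))
        (z_mul_mem_h0 K _ h2 _ (stuffleIdx_mem_h1 K _ _)))
        (z_mul_mem_h0 K _ (by omega) _ (stuffleIdx_mem_h1 K _ _))

/-- The words in `𝔥⁰`. -/
def IsH0Word (w : List Letter) : Prop :=
  w = [] ∨ ∃ m, w = Letter.x :: (m ++ [Letter.y])

lemma h0_le_span : h0 K ≤ Submodule.span K (word K '' {w | IsH0Word w}) := by
  refine sup_le ?_ ?_
  · rw [Submodule.span_singleton_le_iff_mem]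
    exact Submodule.subset_span ⟨[], Or.inl rfl, rfl⟩
  · rintro _ ⟨m, rfl⟩
    induction m using MonoidAlgebra.induction_linear with
    | zero => simp
    | add f g hf hg => rw [map_add]; exact add_mem hf hg
    | single w r =>
      have h : (MonoidAlgebra.single w r : H K) = r • word K w.toList := by
        simp [word]
      rw [h, map_smul]
      refine Submodule.smul_mem _ _ (Submodule.subset_span
        ⟨Letter.x :: (w.toList ++ [Letter.y]), Or.inr ⟨_, rfl⟩, ?_⟩)
      rw [word_cons, word_append]
      rfl

lemma bilinOfWords_mem_h0 (f : List Letter → List Letter → H K)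
    (hf : ∀ u v, IsH0Word u → IsH0Word v → f u v ∈ h0 K) (u v : H K)
    (hu : u ∈ h0 K) (hv : v ∈ h0 K) : bilinOfWords K f u v ∈ h0 K := by
  have h := Submodule.apply_mem_map₂ (bilinOfWords K f) (h0_le_span K hu) (h0_le_span K hv)
  rw [Submodule.map₂_span_span] at h
  refine Submodule.span_le.2 ?_ h
  rintro _ ⟨_, ⟨a, ha, rfl⟩, _, ⟨b, hb, rfl⟩, rfl⟩
  show bilinOfWords K f (word K a) (word K b) ∈ h0 K
  rw [bilinOfWords_word]
  exact hf a b ha hb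

lemma shuffleWord_mem_mul_y (u v : List Letter) (hu : ∀ a ∈ u.getLast?, a = Letter.y)
    (hv : ∀ a ∈ v.getLast?, a = Letter.y) (huv : u ≠ [] ∨ v ≠ []) :
    ∃ m : H K, shuffleWord K u v = m * Y K := by
  have base : ∀ w : List Letter, (∀ a ∈ w.getLast?, a = Letter.y) → w ≠ [] →
      ∃ m : H K, word K w = m * Y K := by
    intro w hw hne
    obtain ⟨p, a, rfl⟩ := List.eq_nil_or_concat w |>.resolve_left hne
    obtain rfl : a = Letter.y := hw a (by simp)
    exact ⟨word K p, by rw [List.concat_eq_append, word_append]; rfl⟩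
  have tail : ∀ (a : Letter) (w : List Letter), (∀ c ∈ (a :: w).getLast?, c = Letter.y) →
      ∀ c ∈ w.getLast?, c = Letter.y := by
    intro a w h c hc
    refine h c ?_
    cases w with
    | nil => simp at hc
    | cons b w => simpa using hc
  induction u, v using shuffleWord.induct with
  | case1 v => rw [shuffleWord]; exact base v hv (by simpa using huv)
  | case2 a u => rw [shuffleWord]; exact base _ hu (by simp)
  | case3 a u b v ih1 ih2 =>
    obtain ⟨m1, h1⟩ := ih1 (tail a u hu) hv (by simp)
    obtain ⟨m2, h2⟩ := ih2 hu (tail b v hv) (by simp)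
    exact ⟨word K [a] * m1 + word K [b] * m2, by
      rw [shuffleWord, h1, h2, add_mul, mul_assoc, mul_assoc]⟩

lemma word_mem_h0 (w : List Letter) (hw : IsH0Word w) : word K w ∈ h0 K := by
  rcases hw with rfl | ⟨m, rfl⟩
  · exact one_mem_h0 K
  · rw [word_cons, word_append]
    exact X_mul_mul_Y_mem_h0 K _

/-- `𝔥⁰` is closed under the shuffle product. -/
lemma shuffle_mem_h0 (u v : H K) (hu : u ∈ h0 K) (hv : v ∈ h0 K) : shuffle K u v ∈ h0 K := by
  refine bilinOfWords_mem_h0 K _ (fun u v hu hv => ?_) u v hu hv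
  rcases hu with rfl | ⟨m, rfl⟩
  · rw [shuffleWord]; exact word_mem_h0 K v hv
  rcases hv with rfl | ⟨p, rfl⟩
  · rw [shuffleWord]; exact word_mem_h0 K _ (Or.inr ⟨m, rfl⟩)
  rw [shuffleWord]
  refine add_mem ?_ ?_
  · obtain ⟨q, hq⟩ := shuffleWord_mem_mul_y K (m ++ [Letter.y]) (Letter.x :: (p ++ [Letter.y]))
      (by simp) (by simp [List.getLast?_cons]) (by simp)
    rw [hq]
    exact X_mul_mul_Y_mem_h0 K _
  · obtain ⟨q, hq⟩ := shuffleWord_mem_mul_y K (Letter.x :: (m ++ [Letter.y])) (p ++ [Letter.y])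
      (by simp [List.getLast?_cons]) (by simp) (by simp)
    rw [hq]
    exact X_mul_mul_Y_mem_h0 K _

lemma decodeAux_admissible (m : List Letter) (c : ℕ) :
    (∀ k ∈ decodeAux c m, 1 ≤ k) ∧ ∀ k ∈ (decodeAux c m).head?, c + 1 ≤ k := by
  induction m generalizing c with
  | nil => simp [decodeAux]
  | cons a m ih =>
    cases a with
    | x =>
      rw [decodeAux]
      exact ⟨(ih (c + 1)).1, fun k hk => by have := (ih (c + 1)).2 k hk; omega⟩
    | y =>
      rw [decodeAux]
      refine ⟨?_, by simp⟩
      intro k hk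
      rcases List.mem_cons.1 hk with rfl | hk
      · omega
      · exact (ih 0).1 k hk

lemma decode_admissible (w : List Letter) (hw : IsH0Word w) : Admissible (decode w) := by
  rcases hw with rfl | ⟨m, rfl⟩
  · simp [decode, decodeAux, Admissible]
  · rw [decode, decodeAux]
    exact decodeAux_admissible _ _

/-- `𝔥⁰` is closed under the stuffle product. -/
lemma stuffle_mem_h0 (u v : H K) (hu : u ∈ h0 K) (hv : v ∈ h0 K) : stuffle K u v ∈ h0 K :=
  bilinOfWords_mem_h0 K _ (fun _ _ hu hv =>
    stuffleIdx_mem_h0 K _ _ (decode_admissible _ hu) (decode_admissible _ hv)) u v hu hv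

/-- The `i`-th power `y^{⧢ i}`. -/
def shufflePowY : ℕ → H K
  | 0 => 1
  | i + 1 => shuffle K (Y K) (shufflePowY i)

/-- The `i`-th power `y^{* i}`. -/
def stufflePowY : ℕ → H K
  | 0 => 1
  | i + 1 => stuffle K (Y K) (stufflePowY i)

/-- `∑ w_i ⧢ y^{⧢ i}` for a finitely supported sequence `(w_i)` in `𝔥⁰`. As `𝔥¹` with `⧢` is
the polynomial algebra `𝔥⁰[y]`, each element of `𝔥¹` is of this form for exactly one `(w_i)`. -/
def shuffleExpand (w : ℕ →₀ h0 K) : H K :=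
  w.sum fun i wi => shuffle K (wi : H K) (shufflePowY K i)

/-- `∑ w_i * y^{* i}` for a finitely supported sequence `(w_i)` in `𝔥⁰`. As `𝔥¹` with `*` is
the polynomial algebra `𝔥⁰[y]`, each element of `𝔥¹` is of this form for exactly one `(w_i)`. -/
def stuffleExpand (w : ℕ →₀ h0 K) : H K :=
  w.sum fun i wi => stuffle K (wi : H K) (stufflePowY K i)

end Products

section Zeta

variable {K : Type*} [Field K] {R : Type*} [CommRing R] [Algebra K R]

/-- The polynomial `∑ Z_R(w_i) T^i`. It is `Z_R^⧢(w)` if `w = ∑ w_i ⧢ y^{⧢ i}`, and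
`Z_R^*(w)` if `w = ∑ w_i * y^{* i}`. -/
def regPoly (Z : h0 K →ₗ[K] R) (w : ℕ →₀ h0 K) : Polynomial R :=
  w.sum fun i wi => Polynomial.monomial i (Z wi)

open Classical in
/-- `ζ_R(k_1, …, k_n) = Z_R(z_{k_1} ⋯ z_{k_n})` for an admissible index (and `0` by default). -/
def zeta (Z : h0 K →ₗ[K] R) (ks : List ℕ) : R :=
  if h : Admissible ks then Z ⟨zWord K ks, zWord_mem_h0 K ks h⟩ else 0

/-- The series `∑_{n ≥ 2} (-1)^n / n * ζ_R(n) u^n`. -/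
def logA (Z : h0 K →ₗ[K] R) : PowerSeries R :=
  PowerSeries.mk fun n => if 2 ≤ n then ((-1) ^ n / (n : K)) • zeta Z [n] else 0

lemma hasSubst_logA (Z : h0 K →ₗ[K] R) : PowerSeries.HasSubst (logA Z) :=
  PowerSeries.HasSubst.of_constantCoeff_zero' (by simp [logA])

variable [CharZero K]

/-- `A_R(u) = exp (∑_{n ≥ 2} (-1)^n / n * ζ_R(n) u^n)`. -/
def seriesA (Z : h0 K →ₗ[K] R) : PowerSeries R :=
  (PowerSeries.exp K).subst (logA Z)

/-- The `R`-linear map `ρ_R : R[T] → R[T]` with `ρ_R(e^{Tu}) = A_R(u) e^{Tu}`: comparing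
coefficients of `u^n`, `ρ_R(T^n) = ∑_{i ≤ n} n! / (n - i)! * a_i T^{n-i}` where
`A_R(u) = ∑ a_i u^i`. -/
def rho (Z : h0 K →ₗ[K] R) : Polynomial R →ₗ[R] Polynomial R :=
  (Polynomial.basisMonomials R).constr R fun n =>
    ∑ i ∈ Finset.range (n + 1),
      Polynomial.monomial (n - i) ((n.descFactorial i : R) * PowerSeries.coeff i (seriesA Z))

/-- `Z_R : 𝔥⁰ → R` satisfies the regularized double shuffle relations: it is a unital algebra
homomorphism for both products, and `Z_R^⧢ = ρ_R ∘ Z_R^*` on `𝔥¹`. -/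
structure RegularizedDoubleShuffle (Z : h0 K →ₗ[K] R) : Prop where
  map_one : Z ⟨1, one_mem_h0 K⟩ = 1
  map_shuffle : ∀ u v : h0 K,
    Z ⟨shuffle K (u : H K) (v : H K), shuffle_mem_h0 K _ _ u.2 v.2⟩ = Z u * Z v
  map_stuffle : ∀ u v : h0 K,
    Z ⟨stuffle K (u : H K) (v : H K), stuffle_mem_h0 K _ _ u.2 v.2⟩ = Z u * Z v
  regularized : ∀ w w' : ℕ →₀ h0 K, shuffleExpand K w = stuffleExpand K w' →
    regPoly Z w = rho Z (regPoly Z w')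

/-- The finite set of `(k_1, …, k_n)` with `k_i ≥ 1` and `k_1 + ⋯ + k_n = k`. -/
def compositions (n k : ℕ) : Finset (Fin n → ℕ) :=
  (Finset.Nat.antidiagonalTuple n k).filter fun κ => ∀ i, 1 ≤ κ i

end Zeta

end DoubleShuffle

end

/-! Under the stuffle product `z_{2k}`, `z_2^k` and `evenSum n k` behave like symmetric functions:
the power sum `p_k`, the elementary `e_k`, and the sum of all monomial functions of degree `k` in
exactly `n` variables. With `S_n(t) = ∑ s(n,k) t^k`, comparing coefficients of `w^n` in `∏(1 - t
x_i) · ∏(1 + w t x_i / (1 - t x_i)) = ∏(1 - (1 - w) t x_i)` gives `E(-t) S_n(t) = ∑ (-1)^{n+k}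
C(k,n) e_k t^k`. This is `evenConv_eq`, proved directly on words; `newton_z_two_pow` is Newton's
identity.

The other input is Euler's recursion for even zeta values, `euler_recursion`. An alternating sum of
shuffle products collapses to a single word, the plain sum of stuffle products is computed by the
sum formula for double zetas, and their difference isolates products of even zetas. Through `E'/E`
the recursion becomes a Riccati equation, which linearizes to a second-order equation for `E`
(`elementary_recursion`). So each value of `z_2^k` is a rational multiple of `ζ(2)^k`.

Since `E(-t)` is an invertible power series, the formula for `E(-t) S_n(t)` yields a recursion in
the depth relating `S_{n+2}`, `S_{n+1}` and `S_n` (`depth_recursion`). The coefficients of the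
theorem satisfy the same recursion, and induction gives the first identity. The second follows by
replacing `λ^{2j}` through Euler's formula `zeta_two_mul`, as `B_{2j}` is nonzero.

Throughout, `Zt` is an arbitrary linear extension of `Z` to all of `𝔥`. Its values on words starting
with `y` carry no meaning and cancel whenever they occur. -/

namespace DoubleShuffle

open Finset

/-! ### Shuffle products of two letters `z_a ⧢ z_b` -/

section Shuffle

variable (K : Type*) [Field K]

lemma word_replicate_append_y (a : ℕ) :
    word K (List.replicate a Letter.x ++ [Letter.y]) = z K (a + 1) := by
  rw [word_append, word_replicate_x]; rfl

lemma z_one : z K 1 = Y K := by simp [z]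

lemma X_mul_z_succ (a : ℕ) : X K * z K (a + 1) = z K (a + 2) := by
  simp only [z, Nat.add_sub_cancel, show a + 2 - 1 = a + 1 by omega, pow_succ', mul_assoc]

lemma shuffle_z_one_z_one : shuffle K (z K 1) (z K 1) = Y K * Y K + Y K * Y K := by
  rw [show z K 1 = word K [Letter.y] from z_one K, shuffle, bilinOfWords_word, shuffleWord,
    shuffleWord, shuffleWord]
  rfl

lemma shuffle_z_one_z (b : ℕ) :
    shuffle K (z K 1) (z K (b + 2)) =
      Y K * z K (b + 2) + X K * shuffle K (z K 1) (z K (b + 1)) := by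
  rw [show z K 1 = word K [Letter.y] from z_one K, ← word_replicate_append_y K (b + 1),
    ← word_replicate_append_y K b, shuffle, bilinOfWords_word, bilinOfWords_word,
    List.replicate_succ, List.cons_append, shuffleWord, shuffleWord]
  rfl

lemma shuffle_z_z_one (a : ℕ) :
    shuffle K (z K (a + 2)) (z K 1) =
      X K * shuffle K (z K (a + 1)) (z K 1) + Y K * z K (a + 2) := by
  have h : ∀ w : List Letter, w ≠ [] → shuffleWord K w [] = word K w := by
    intro w hw
    cases w with
    | nil => exact absurd rfl hw
    | cons c w => rw [shuffleWord]
  rw [show z K 1 = word K [Letter.y] from z_one K, ← word_replicate_append_y K (a + 1),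
    ← word_replicate_append_y K a, shuffle, bilinOfWords_word, bilinOfWords_word,
    List.replicate_succ, List.cons_append, shuffleWord, h _ (by simp)]
  rfl

lemma shuffle_z_z (a b : ℕ) :
    shuffle K (z K (a + 2)) (z K (b + 2)) =
      X K * shuffle K (z K (a + 1)) (z K (b + 2)) +
        X K * shuffle K (z K (a + 2)) (z K (b + 1)) := by
  simp only [← word_replicate_append_y K, shuffle, bilinOfWords_word, List.replicate_succ,
    List.cons_append]
  rw [shuffleWord]
  rfl

/-- `z_{a+1} ⧢ y`. -/
lemma shuffle_z_z_one_eq_sum (a : ℕ) :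
    shuffle K (z K (a + 1)) (z K 1) =
      ∑ p ∈ antidiagonal a, z K (p.1 + 1) * z K (p.2 + 1) + z K (a + 1) * Y K := by
  induction a with
  | zero => simpa [z_one] using shuffle_z_one_z_one K
  | succ a ih =>
    rw [shuffle_z_z_one, ih, Nat.sum_antidiagonal_succ, mul_add, mul_sum, zero_add, z_one,
      ← mul_assoc, X_mul_z_succ]
    simp only [← mul_assoc, X_mul_z_succ]
    abel

lemma shuffle_z_one_z_eq_sum (a : ℕ) :
    shuffle K (z K 1) (z K (a + 1)) =
      ∑ p ∈ antidiagonal a, z K (p.1 + 1) * z K (p.2 + 1) + z K (a + 1) * Y K := by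
  induction a with
  | zero => simpa [z_one] using shuffle_z_one_z_one K
  | succ a ih =>
    rw [shuffle_z_one_z, ih, Nat.sum_antidiagonal_succ, mul_add, mul_sum, zero_add, z_one,
      ← mul_assoc, X_mul_z_succ]
    simp only [← mul_assoc, X_mul_z_succ]
    abel

/-- The alternating sum of the shuffle products `z_r ⧢ z_s` with `r + s` fixed. -/
lemma alternating_sum_shuffle (n : ℕ) :
    ∑ p ∈ antidiagonal (n + 2), (-1 : K) ^ p.1 • shuffle K (z K (p.1 + 1)) (z K (p.2 + 1)) =
      (1 + (-1 : K) ^ n) • (Y K * z K (n + 3)) := by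
  set f : ℕ → ℕ → H K := fun a b => shuffle K (z K (a + 1)) (z K (b + 1)) with hf
  have hr : ∀ a b, f (a + 1) (b + 1) = X K * f a (b + 1) + X K * f (a + 1) b :=
    fun a b => shuffle_z_z K a b
  have h0 : f 0 (n + 2) = Y K * z K (n + 3) + X K * f 0 (n + 1) := shuffle_z_one_z K (n + 1)
  have h1 : f (n + 2) 0 = X K * f (n + 1) 0 + Y K * z K (n + 3) := shuffle_z_z_one K (n + 1)
  -- `e1` and `e2` split the same alternating sum at its two ends. Equating them gives `e4`: the
  -- interior terms telescope to the two boundary values, which cancel the `X`-parts of `h0` and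
  -- `h1`.
  have e1 : ∑ p ∈ antidiagonal (n + 1), (-1 : K) ^ p.1 • f p.1 p.2 =
      f 0 (n + 1) - ∑ p ∈ antidiagonal n, (-1 : K) ^ p.1 • f (p.1 + 1) p.2 := by
    rw [Nat.sum_antidiagonal_succ, sub_eq_add_neg, ← sum_neg_distrib]
    simp [pow_succ]
  have e2 : ∑ p ∈ antidiagonal (n + 1), (-1 : K) ^ p.1 • f p.1 p.2 =
      (-1 : K) ^ (n + 1) • f (n + 1) 0 +
        ∑ p ∈ antidiagonal n, (-1 : K) ^ p.1 • f p.1 (p.2 + 1) := by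
    rw [Nat.sum_antidiagonal_succ']
  have e3 : ∑ p ∈ antidiagonal n, (-1 : K) ^ (p.1 + 1) • f (p.1 + 1) (p.2 + 1) =
      -(X K * (∑ p ∈ antidiagonal n, (-1 : K) ^ p.1 • f p.1 (p.2 + 1) +
        ∑ p ∈ antidiagonal n, (-1 : K) ^ p.1 • f (p.1 + 1) p.2)) := by
    rw [← sum_add_distrib, mul_sum, ← sum_neg_distrib]
    refine sum_congr rfl fun p _ => ?_
    rw [hr, ← smul_add, mul_smul_comm, mul_add, pow_succ, mul_neg_one, neg_smul]
  have e4 : ∑ p ∈ antidiagonal n, (-1 : K) ^ p.1 • f p.1 (p.2 + 1) +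
        ∑ p ∈ antidiagonal n, (-1 : K) ^ p.1 • f (p.1 + 1) p.2 =
      f 0 (n + 1) + (-1 : K) ^ n • f (n + 1) 0 := by
    rw [e1] at e2
    rw [eq_sub_of_add_eq' e2.symm, pow_succ, mul_neg_one, neg_smul]
    abel
  change ∑ p ∈ antidiagonal (n + 2), (-1 : K) ^ p.1 • f p.1 p.2 = _
  rw [Nat.sum_antidiagonal_succ, Nat.sum_antidiagonal_succ', e3, e4, h0, h1]
  rcases neg_one_pow_eq_or K n with h | h <;>
  · simp only [pow_succ, h, mul_add, add_smul, pow_zero, one_smul, mul_neg, mul_one,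
      neg_neg, neg_smul]
    abel

end Shuffle

/-! ### Stuffle identities among the words in even letters `z_{2k}` -/

section Stuffle

variable (K : Type*) [Field K]

/-- The span of the words `z_{k_1} ⋯ z_{k_n}` with all `k_i ≥ 1`. -/
noncomputable def zSpan : Submodule K (H K) :=
  Submodule.span K (zWord K '' {ks | ∀ k ∈ ks, 1 ≤ k})

variable {K}

lemma zWord_mem_zSpan {ks : List ℕ} (h : ∀ k ∈ ks, 1 ≤ k) : zWord K ks ∈ zSpan K :=
  Submodule.subset_span ⟨ks, h, rfl⟩

lemma one_mem_zSpan : (1 : H K) ∈ zSpan K := zWord_mem_zSpan (ks := []) (by simp)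

lemma z_mul_mem_zSpan {a : ℕ} (ha : 1 ≤ a) {u : H K} (hu : u ∈ zSpan K) :
    z K a * u ∈ zSpan K := by
  refine Submodule.span_induction (p := fun u _ => z K a * u ∈ zSpan K) ?_ ?_ ?_ ?_ hu
  · rintro _ ⟨ks, h, rfl⟩
    rw [← zWord_cons]
    exact zWord_mem_zSpan (by simpa using ⟨ha, h⟩)
  · simp
  · intro u v _ _ hu hv
    rw [mul_add]
    exact add_mem hu hv
  · intro r u _ hu
    rw [mul_smul_comm]
    exact Submodule.smul_mem _ _ hu

lemma stuffle_one_left {u : H K} (hu : u ∈ zSpan K) : stuffle K 1 u = u := by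
  refine Submodule.span_induction (p := fun u _ => stuffle K 1 u = u) ?_ ?_ ?_ ?_ hu
  · rintro _ ⟨ks, h, rfl⟩
    have := stuffle_zWord K [] ks (by simp) h
    rwa [stuffleIdx] at this
  · simp
  · intro u v _ _ hu hv
    rw [map_add, hu, hv]
  · intro r u _ hu
    rw [map_smul, hu]

lemma stuffle_one_right {u : H K} (hu : u ∈ zSpan K) : stuffle K u 1 = u := by
  refine Submodule.span_induction (p := fun u _ => stuffle K u 1 = u) ?_ ?_ ?_ ?_ hu
  · rintro _ ⟨ks, h, rfl⟩
    have := stuffle_zWord K ks [] h (by simp)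
    cases ks <;> rwa [stuffleIdx] at this
  · simp
  · intro u v _ _ hu hv
    rw [map_add, LinearMap.add_apply, hu, hv]
  · intro r u _ hu
    rw [map_smul, LinearMap.smul_apply, hu]

/-- The recursion for the stuffle product, on linear combinations of words. -/
lemma stuffle_z_mul_z_mul {a b : ℕ} (ha : 1 ≤ a) (hb : 1 ≤ b) {u v : H K} (hu : u ∈ zSpan K)
    (hv : v ∈ zSpan K) :
    stuffle K (z K a * u) (z K b * v) =
      z K a * stuffle K u (z K b * v) + z K b * stuffle K (z K a * u) v +
        z K (a + b) * stuffle K u v := by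
  refine Submodule.span_induction (p := fun u _ => stuffle K (z K a * u) (z K b * v) =
      z K a * stuffle K u (z K b * v) + z K b * stuffle K (z K a * u) v +
        z K (a + b) * stuffle K u v) ?_ ?_ ?_ ?_ hu
  · rintro _ ⟨ks, hk, rfl⟩
    refine Submodule.span_induction (p := fun v _ =>
      stuffle K (z K a * zWord K ks) (z K b * v) =
      z K a * stuffle K (zWord K ks) (z K b * v) + z K b * stuffle K (z K a * zWord K ks) v +
        z K (a + b) * stuffle K (zWord K ks) v) ?_ ?_ ?_ ?_ hv
    · rintro _ ⟨ls, hl, rfl⟩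
      have hk' : ∀ k ∈ a :: ks, 1 ≤ k := by simpa using ⟨ha, hk⟩
      have hl' : ∀ l ∈ b :: ls, 1 ≤ l := by simpa using ⟨hb, hl⟩
      rw [← zWord_cons, ← zWord_cons, stuffle_zWord K _ _ hk' hl', stuffle_zWord K _ _ hk hl',
        stuffle_zWord K _ _ hk' hl, stuffle_zWord K _ _ hk hl, stuffleIdx]
    · simp
    · intro v w _ _ hv hw
      simp only [mul_add, map_add, hv, hw]
      abel
    · intro r v _ hv
      simp only [mul_smul_comm, map_smul, hv, smul_add]
  · simp
  · intro u w _ _ hu hw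
    simp only [mul_add, map_add, LinearMap.add_apply, hu, hw]
    abel
  · intro r u _ hu
    simp only [mul_smul_comm, map_smul, LinearMap.smul_apply, hu, smul_add]

lemma z_mem_zSpan {a : ℕ} (ha : 1 ≤ a) : z K a ∈ zSpan K := by
  simpa using z_mul_mem_zSpan ha (one_mem_zSpan (K := K))

lemma stuffle_z_z_mul {a b : ℕ} (ha : 1 ≤ a) (hb : 1 ≤ b) {v : H K} (hv : v ∈ zSpan K) :
    stuffle K (z K a) (z K b * v) =
      z K a * (z K b * v) + z K b * stuffle K (z K a) v + z K (a + b) * v := by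
  have h := stuffle_z_mul_z_mul ha hb (one_mem_zSpan (K := K)) hv
  rwa [mul_one, stuffle_one_left hv, stuffle_one_left (z_mul_mem_zSpan hb hv)] at h

lemma stuffle_z_z {a b : ℕ} (ha : 1 ≤ a) (hb : 1 ≤ b) :
    stuffle K (z K a) (z K b) = z K a * z K b + z K b * z K a + z K (a + b) := by
  have h := stuffle_z_z_mul ha hb (one_mem_zSpan (K := K))
  rwa [mul_one, mul_one, stuffle_one_right (z_mem_zSpan ha)] at h

lemma z_two_pow_mem_zSpan (i : ℕ) : z K 2 ^ i ∈ zSpan K := by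
  induction i with
  | zero => simpa using one_mem_zSpan
  | succ i ih => rw [pow_succ']; exact z_mul_mem_zSpan (by norm_num) ih

variable (K) in
/-- The sum of the words obtained by inserting `z_a` into `z_2^n`. -/
noncomputable def insertions (a n : ℕ) : H K :=
  ∑ p ∈ antidiagonal n, z K 2 ^ p.1 * (z K a * z K 2 ^ p.2)

lemma insertions_zero (a : ℕ) : insertions K a 0 = z K a := by simp [insertions]

lemma insertions_succ (a n : ℕ) :
    insertions K a (n + 1) = z K a * z K 2 ^ (n + 1) + z K 2 * insertions K a n := by
  simp [insertions, Nat.sum_antidiagonal_succ, mul_sum, pow_succ', mul_assoc]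

lemma insertions_two (n : ℕ) : insertions K 2 n = ((n : K) + 1) • z K 2 ^ (n + 1) := by
  induction n with
  | zero => simp [insertions_zero]
  | succ n ih =>
    rw [insertions_succ, ih, mul_smul_comm, ← pow_succ']
    push_cast
    module

/-- In each resulting word `z_a` is either inserted between the letters `z_2` or merged with one of
them into `z_{a+2}`. -/
lemma stuffle_z_z_two_pow {a : ℕ} (ha : 1 ≤ a) (n : ℕ) :
    stuffle K (z K a) (z K 2 ^ (n + 1)) = insertions K a (n + 1) + insertions K (a + 2) n := by
  induction n with
  | zero =>
    rw [zero_add, pow_one, stuffle_z_z ha (by norm_num), insertions_succ, insertions_zero,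
      insertions_zero]
    simp
  | succ n ih =>
    rw [pow_succ', stuffle_z_z_mul ha (by norm_num) (z_two_pow_mem_zSpan _), ih, ← pow_succ',
      insertions_succ a (n + 1), insertions_succ (a + 2) n, mul_add]
    abel

/-- Each product is a sum of two consecutive insertion terms, so the alternating sum telescopes. -/
lemma sum_stuffle_z_z_two_pow {a : ℕ} (ha : 1 ≤ a) (k : ℕ) :
    ∑ p ∈ antidiagonal k, (-1 : K) ^ p.1 • stuffle K (z K (a + 2 * p.1)) (z K 2 ^ p.2) =
      insertions K a k := by
  induction k generalizing a with
  | zero => simp [insertions_zero, stuffle_one_right (z_mem_zSpan ha)]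
  | succ k ih =>
    have h := ih (a := a + 2) (by omega)
    have h' : ∑ p ∈ antidiagonal k, (-1 : K) ^ (p.1 + 1) •
        stuffle K (z K (a + 2 * (p.1 + 1))) (z K 2 ^ p.2) = -insertions K (a + 2) k := by
      rw [← h, ← sum_neg_distrib]
      refine sum_congr rfl fun p _ => ?_
      rw [show a + 2 * (p.1 + 1) = a + 2 + 2 * p.1 by ring, pow_succ, mul_neg_one, neg_smul]
    rw [Nat.sum_antidiagonal_succ, h']
    simp [stuffle_z_z_two_pow ha]

/-- Newton's identities for `z_2^k`. -/
lemma newton_z_two_pow (k : ℕ) :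
    ∑ p ∈ antidiagonal k, (-1 : K) ^ p.1 • stuffle K (z K (2 * p.1 + 2)) (z K 2 ^ p.2) =
      ((k : K) + 1) • z K 2 ^ (k + 1) := by
  rw [← insertions_two, ← sum_stuffle_z_z_two_pow (by norm_num)]
  simp only [add_comm]

/-- `∑_{j ≥ 1} z_{2j} g_{k+1-j}`. -/
noncomputable def evenCons (g : ℕ → H K) (k : ℕ) : H K :=
  ∑ p ∈ antidiagonal k, z K (2 * p.1 + 2) * g p.2

lemma evenCons_zero (g : ℕ → H K) : evenCons g 0 = z K 2 * g 0 := by simp [evenCons]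

lemma X_sq_mul_z (a : ℕ) (ha : 1 ≤ a) : X K ^ 2 * z K a = z K (a + 2) := by
  obtain ⟨b, rfl⟩ : ∃ b, a = b + 1 := ⟨a - 1, by omega⟩
  rw [pow_two, mul_assoc, X_mul_z_succ, X_mul_z_succ]

/-- Words whose first letter is not `z_2` arise from a first letter smaller by 2, through left
multiplication by `x²`. -/
lemma evenCons_succ (g : ℕ → H K) (k : ℕ) :
    evenCons g (k + 1) = z K 2 * g (k + 1) + X K ^ 2 * evenCons g k := by
  rw [evenCons, Nat.sum_antidiagonal_succ, evenCons, mul_sum]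
  congr 1
  refine sum_congr rfl fun p _ => ?_
  rw [← mul_assoc, X_sq_mul_z _ (by omega)]
  rfl

lemma evenCons_mem_zSpan {g : ℕ → H K} (hg : ∀ k, g k ∈ zSpan K) (k : ℕ) :
    evenCons g k ∈ zSpan K :=
  Submodule.sum_mem _ fun _ _ => z_mul_mem_zSpan (by omega) (hg _)

/-- The three terms record whether the first letter comes from the left factor, from the right one,
or from merging both; a merged letter is `z_{2j+2} = x² z_{2j}`. -/
lemma stuffle_z_two_mul_evenCons {g : ℕ → H K} (hg : ∀ k, g k ∈ zSpan K) {u : H K}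
    (hu : u ∈ zSpan K) (k : ℕ) :
    stuffle K (z K 2 * u) (evenCons g k) =
      z K 2 * stuffle K u (evenCons g k) + evenCons (fun j => stuffle K (z K 2 * u) (g j)) k +
        X K ^ 2 * evenCons (fun j => stuffle K u (g j)) k := by
  simp only [evenCons, map_sum, mul_sum, ← sum_add_distrib]
  refine sum_congr rfl fun p _ => ?_
  rw [stuffle_z_mul_z_mul (by norm_num) (by omega) hu (hg _), ← mul_assoc (X K ^ 2),
    X_sq_mul_z _ (by omega), add_comm 2 (2 * p.1 + 2)]

variable (K) in
/-- The sum of the words `z_{2k_1} ⋯ z_{2k_n}` with `k_1 + ⋯ + k_n = k`. -/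
noncomputable def evenSum : ℕ → ℕ → H K
  | 0, 0 => 1
  | 0, _ + 1 => 0
  | _ + 1, 0 => 0
  | n + 1, k + 1 => evenCons (evenSum n) k

lemma evenSum_mem_zSpan (n k : ℕ) : evenSum K n k ∈ zSpan K := by
  induction n generalizing k with
  | zero => cases k <;> simp [evenSum, one_mem_zSpan]
  | succ n ih =>
    cases k with
    | zero => simp [evenSum]
    | succ k => rw [evenSum]; exact evenCons_mem_zSpan ih k

variable (K) in
/-- `∑ (-1)^i z_2^i * evenSum n (k - i)`. -/
noncomputable def evenConv (n k : ℕ) : H K :=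
  ∑ p ∈ antidiagonal k, (-1 : K) ^ p.1 • stuffle K (z K 2 ^ p.1) (evenSum K n p.2)

lemma evenConv_zero (k : ℕ) : evenConv K 0 k = (-1 : K) ^ k • z K 2 ^ k := by
  cases k with
  | zero => simp [evenConv, evenSum, stuffle_one_right one_mem_zSpan]
  | succ k =>
    rw [evenConv, Nat.sum_antidiagonal_succ', sum_eq_zero fun p _ => by simp [evenSum], add_zero,
      evenSum, stuffle_one_right (z_two_pow_mem_zSpan _)]

lemma evenConv_succ_zero (n : ℕ) : evenConv K (n + 1) 0 = 0 := by simp [evenConv, evenSum]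

lemma evenConv_succ_eq (n k : ℕ) : evenConv K (n + 1) (k + 1) =
    ∑ p ∈ antidiagonal k, (-1 : K) ^ p.1 • stuffle K (z K 2 ^ p.1) (evenCons (evenSum K n) p.2) := by
  rw [evenConv, Nat.sum_antidiagonal_succ']
  simp [evenSum]

lemma evenConv_succ_one (n : ℕ) : evenConv K (n + 1) 1 = z K 2 * evenConv K n 0 := by
  rw [evenConv_succ_eq]
  simp [evenConv, evenCons_zero, stuffle_one_left (evenSum_mem_zSpan _ _),
    stuffle_one_left (z_mul_mem_zSpan (by norm_num : 1 ≤ 2) (evenSum_mem_zSpan (K := K) n 0))]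

lemma evenConv_succ_succ (n k : ℕ) :
    evenConv K (n + 1) (k + 2) = z K 2 * evenConv K n (k + 1) - z K 2 * evenConv K (n + 1) (k + 1) := by
  set g := evenSum K n with hg
  have hgm : ∀ k, g k ∈ zSpan K := evenSum_mem_zSpan n
  -- `U` collects the terms whose first letter comes from the even-letter factor. Expanding the
  -- stuffle products gives `hX`, peeling off first letters `z_2` gives `hY`, and `U` drops out
  -- between the two.
  set U : ℕ → H K := fun k => ∑ p ∈ antidiagonal k,
    (-1 : K) ^ p.1 • evenCons (fun j => stuffle K (z K 2 ^ p.1) (g j)) p.2 with hU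
  have h1 : ∀ f : ℕ → ℕ → H K, ∑ p ∈ antidiagonal (k + 1), (-1 : K) ^ p.1 • f p.1 p.2 =
      f 0 (k + 1) - ∑ p ∈ antidiagonal k, (-1 : K) ^ p.1 • f (p.1 + 1) p.2 := by
    intro f
    rw [Nat.sum_antidiagonal_succ, sub_eq_add_neg, ← sum_neg_distrib]
    simp [pow_succ]
  have hone : stuffle K (z K 2 ^ 0) (evenCons g (k + 1)) = evenCons g (k + 1) := by
    rw [pow_zero, stuffle_one_left (evenCons_mem_zSpan hgm _)]
  have hone' : (fun j => stuffle K (z K 2 ^ 0) (g j)) = g := by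
    funext j
    rw [pow_zero, stuffle_one_left (hgm j)]
  have hX : evenConv K (n + 1) (k + 2) =
      U (k + 1) - z K 2 * evenConv K (n + 1) (k + 1) - X K ^ 2 * U k := by
    have hUk : U (k + 1) = evenCons g (k + 1) - ∑ p ∈ antidiagonal k,
        (-1 : K) ^ p.1 • evenCons (fun j => stuffle K (z K 2 ^ (p.1 + 1)) (g j)) p.2 := by
      have := h1 fun i => evenCons fun j => stuffle K (z K 2 ^ i) (g j)
      rw [hone'] at this
      exact this
    rw [evenConv_succ_eq, evenConv_succ_eq,
      h1 fun i j => stuffle K (z K 2 ^ i) (evenCons g j), hone, hUk, hU]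
    simp only [pow_succ' (z K 2), stuffle_z_two_mul_evenCons hgm (z_two_pow_mem_zSpan _), smul_add,
      sum_add_distrib, mul_sum, mul_smul_comm]
    abel
  have hY : U (k + 1) = X K ^ 2 * U k + z K 2 * evenConv K n (k + 1) := by
    rw [hU, evenConv]
    simp only [Nat.sum_antidiagonal_succ', evenCons_zero, evenCons_succ, smul_add,
      sum_add_distrib, mul_add, mul_sum, mul_smul_comm]
    abel
  rw [hX, hY]
  abel

/-- The recursion in `evenConv_succ_succ` is Pascal's rule up to sign, with every step prepending
one `z_2`. -/
lemma evenConv_eq (n k : ℕ) :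
    evenConv K n k = ((-1 : K) ^ (n + k) * (k.choose n : K)) • z K 2 ^ k := by
  induction k generalizing n with
  | zero => cases n <;> simp [evenConv_zero, evenConv_succ_zero]
  | succ k ih =>
    cases n with
    | zero => simp [evenConv_zero]
    | succ n =>
      cases k with
      | zero =>
        rw [zero_add, evenConv_succ_one, ih]
        cases n <;> simp [Nat.choose_succ_succ]
      | succ k =>
        rw [evenConv_succ_succ, ih, ih, mul_smul_comm, mul_smul_comm, ← pow_succ', ← sub_smul,
          Nat.choose_succ_succ (k + 1) n]
        congr 1
        push_cast
        ring

end Stuffle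

/-- When the total is even, both indices have the same parity; this splits the sum accordingly. -/
lemma sum_antidiagonal_two_mul {M : Type*} [AddCommMonoid M] (h : ℕ → ℕ → M) (r : ℕ) :
    ∑ p ∈ antidiagonal (2 * r + 2), h p.1 p.2 =
      ∑ p ∈ antidiagonal (r + 1), h (2 * p.1) (2 * p.2) +
        ∑ p ∈ antidiagonal r, h (2 * p.1 + 1) (2 * p.2 + 1) := by
  induction r generalizing h with
  | zero => simp [Nat.sum_antidiagonal_succ]; abel
  | succ r ih =>
    have e0 : ∑ p ∈ antidiagonal (r + 2), h (2 * p.1) (2 * p.2) =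
        h 0 (2 * r + 4) + ∑ p ∈ antidiagonal (r + 1), h (2 * p.1 + 1 + 1) (2 * p.2) :=
      Nat.sum_antidiagonal_succ
    have e1 : ∑ p ∈ antidiagonal (r + 1), h (2 * p.1 + 1) (2 * p.2 + 1) =
        h 1 (2 * r + 3) + ∑ p ∈ antidiagonal r, h (2 * p.1 + 1 + 1 + 1) (2 * p.2 + 1) :=
      Nat.sum_antidiagonal_succ
    rw [show 2 * (r + 1) + 2 = 2 * r + 2 + 1 + 1 by ring, Nat.sum_antidiagonal_succ,
      Nat.sum_antidiagonal_succ, ih fun a b => h (a + 1 + 1) b, e0, e1]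
    simp only [zero_add]
    abel

/-! ### Consequences of the double shuffle relations: sum formula and Euler's recursion -/

section Zeta

variable {K : Type*} [Field K] {R : Type*} [CommRing R] [Algebra K R]

lemma neg_one_pow_smul (i : ℕ) (x : R) : (-1 : K) ^ i • x = (-1) ^ i * x := by
  rcases Nat.even_or_odd i with h | h <;> simp [h.neg_one_pow]

variable {Z : h0 K →ₗ[K] R} {Zt : H K →ₗ[K] R}

lemma extension_zWord (hZt : Zt ∘ₗ (h0 K).subtype = Z) {ks : List ℕ} (h : Admissible ks) :
    Zt (zWord K ks) = zeta Z ks := by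
  rw [zeta, dif_pos h, ← hZt]
  rfl

lemma extension_z (hZt : Zt ∘ₗ (h0 K).subtype = Z) {a : ℕ} (ha : 2 ≤ a) :
    Zt (z K a) = zeta Z [a] := by
  rw [← extension_zWord hZt (by simp [Admissible]; omega)]
  simp [zWord]

lemma z_mem_h0 {a : ℕ} (ha : 2 ≤ a) : z K a ∈ h0 K := by
  simpa using z_mul_mem_h0 K a ha 1 (one_mem_h1 K)

lemma z_mem_h1 (a : ℕ) : z K a ∈ h1 K := by
  simpa using z_mul_mem_h1 K a 1 (one_mem_h1 K)

lemma shuffle_Y_one : shuffle K (Y K) 1 = Y K := by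
  rw [← word_nil, Y, shuffle, bilinOfWords_word, shuffleWord]

variable [CharZero K]

/-- `logA` starts in degree 2, so its exponential has no linear term. Hence `ρ_R` acts trivially on
polynomials of degree at most 1, the only case of the regularization that is needed. -/
lemma coeff_seriesA (Z : h0 K →ₗ[K] R) :
    PowerSeries.coeff 0 (seriesA Z) = 1 ∧ PowerSeries.coeff 1 (seriesA Z) = 0 := by
  have h : seriesA Z = 1 + logA Z *
      PowerSeries.substAlgHom (hasSubst_logA Z) (PowerSeries.mk fun p =>
        PowerSeries.coeff (p + 1) (PowerSeries.exp K)) := by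
    rw [seriesA, ← PowerSeries.coe_substAlgHom (hasSubst_logA Z)]
    conv_lhs => rw [PowerSeries.eq_X_mul_shift_add_const (PowerSeries.exp K)]
    rw [map_add, map_mul, PowerSeries.substAlgHom_X]
    simp [add_comm]
  rw [h]
  constructor <;> simp [PowerSeries.coeff_mul, Nat.sum_antidiagonal_succ, logA]

lemma coeff_zero_rho (Z : h0 K →ₗ[K] R) (r s : R) :
    (rho Z (Polynomial.monomial 1 r + Polynomial.monomial 0 s)).coeff 0 = s := by
  have h : ∀ (n : ℕ) (r : R), rho Z (Polynomial.monomial n r) = r • ∑ i ∈ Finset.range (n + 1),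
      Polynomial.monomial (n - i) ((n.descFactorial i : R) * PowerSeries.coeff i (seriesA Z)) := by
    intro n r
    rw [show Polynomial.monomial n r = r • Polynomial.basisMonomials R n by
      simp [Polynomial.smul_monomial], map_smul, rho, Module.Basis.constr_basis]
  rw [map_add, h, h]
  obtain ⟨h0, h1⟩ := coeff_seriesA Z
  simp [sum_range_succ, Polynomial.coeff_monomial, h1]
  rw [show PowerSeries.constantCoeff (seriesA Z) = 1 by simpa using h0, mul_one]

lemma extension_one (hZ : RegularizedDoubleShuffle Z) (hZt : Zt ∘ₗ (h0 K).subtype = Z) : Zt 1 = 1 := by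
  rw [← hZ.map_one, ← hZt]
  rfl

lemma extension_stuffle (hZ : RegularizedDoubleShuffle Z) (hZt : Zt ∘ₗ (h0 K).subtype = Z)
    {u v : H K} (hu : u ∈ h0 K) (hv : v ∈ h0 K) :
    Zt (stuffle K u v) = Zt u * Zt v := by
  have h := hZ.map_stuffle ⟨u, hu⟩ ⟨v, hv⟩
  rw [← hZt] at h
  exact h

lemma extension_shuffle (hZ : RegularizedDoubleShuffle Z) (hZt : Zt ∘ₗ (h0 K).subtype = Z)
    {u v : H K} (hu : u ∈ h0 K) (hv : v ∈ h0 K) :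
    Zt (shuffle K u v) = Zt u * Zt v := by
  have h := hZ.map_shuffle ⟨u, hu⟩ ⟨v, hv⟩
  rw [← hZt] at h
  exact h

/-- The sum formula for double zeta values. -/
lemma sum_extension_z_mul_z (hZ : RegularizedDoubleShuffle Z) (hZt : Zt ∘ₗ (h0 K).subtype = Z)
    (a : ℕ) :
    ∑ p ∈ antidiagonal a, Zt (z K (p.1 + 2) * z K (p.2 + 1)) = Zt (z K (a + 3)) := by
  have hw : z K (a + 2) ∈ h0 K := z_mem_h0 (by omega)
  have hd : ∑ p ∈ antidiagonal a, z K (p.1 + 2) * z K (p.2 + 1) - z K (a + 3) ∈ h0 K :=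
    sub_mem (Submodule.sum_mem _ fun p _ => z_mul_mem_h0 K _ (by omega) _ (z_mem_h1 _))
      (z_mem_h0 (by omega))
  -- The regularization relation is applied to `z_{a+2} ⧢ y = z_{a+2} * y + d`, where `d` lies in
  -- `𝔥⁰` because the words starting with `y` cancel. Constant terms in `T` then give `Z(d) = 0`.
  have h := hZ.regularized (Finsupp.single 1 ⟨_, hw⟩)
    (Finsupp.single 1 ⟨_, hw⟩ + Finsupp.single 0 ⟨_, hd⟩) (by
      rw [shuffleExpand, stuffleExpand, Finsupp.sum_add_index' (by simp) (by simp)]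
      simp only [Finsupp.sum_single_index, ZeroMemClass.coe_zero, map_zero, LinearMap.zero_apply,
        shufflePowY, stufflePowY, ← z_one K]
      rw [z_one, shuffle_Y_one, ← z_one K, stuffle_one_right (z_mem_zSpan le_rfl),
        stuffle_z_z (by omega) le_rfl, shuffle_z_z_one_eq_sum K (a + 1), stuffle_one_right,
        Nat.sum_antidiagonal_succ, z_one]
      · simp only [add_assoc, one_add_one_eq_two, show 2 + 1 = 3 from rfl]
        abel
      · exact sub_mem (Submodule.sum_mem _ fun p _ => z_mul_mem_zSpan (by omega)
          (z_mem_zSpan (by omega))) (z_mem_zSpan (by omega)))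
  have h' := congrArg (fun q => Polynomial.coeff q 0) h
  simp only [regPoly] at h'
  rw [Finsupp.sum_add_index' (by simp) (by simp), Finsupp.sum_single_index (by simp),
    Finsupp.sum_single_index (by simp), coeff_zero_rho, ← hZt] at h'
  have h2 : (0 : R) = Zt (∑ p ∈ antidiagonal a, z K (p.1 + 2) * z K (p.2 + 1) - z K (a + 3)) := by
    simpa [Polynomial.coeff_monomial] using h'
  rw [map_sub, map_sum] at h2
  exact (sub_eq_zero.1 h2.symm)

/-- If one factor is `y`, the same word starting with `y` occurs in both products, and the rest is
the sum formula. The case `a = b = 0` must be excluded: `y * y` exceeds `y ⧢ y` by `z_2`. -/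
lemma extension_shuffle_eq_stuffle (hZ : RegularizedDoubleShuffle Z) (hZt : Zt ∘ₗ (h0 K).subtype = Z)
    {a b : ℕ} (h : 0 < a + b) :
    Zt (shuffle K (z K (a + 1)) (z K (b + 1))) =
      Zt (stuffle K (z K (a + 1)) (z K (b + 1))) := by
  rcases a with _ | a
  · obtain ⟨b, rfl⟩ : ∃ c, b = c + 1 := ⟨b - 1, by omega⟩
    rw [stuffle_z_z (by omega) (by omega), zero_add, shuffle_z_one_z_eq_sum K (b + 1),
      Nat.sum_antidiagonal_succ]
    simp only [map_add, map_sum, zero_add, add_assoc, one_add_one_eq_two]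
    rw [sum_extension_z_mul_z hZ hZt, z_one, show 1 + (b + 2) = b + 3 by ring]
    abel
  rcases b with _ | b
  · rw [stuffle_z_z (by omega) (by omega), zero_add, shuffle_z_z_one_eq_sum K (a + 1),
      Nat.sum_antidiagonal_succ]
    simp only [map_add, map_sum, zero_add, add_assoc, one_add_one_eq_two]
    rw [sum_extension_z_mul_z hZ hZt, z_one, show 2 + 1 = 3 from rfl]
    abel
  rw [extension_shuffle hZ hZt (z_mem_h0 (by omega)) (z_mem_h0 (by omega)),
    extension_stuffle hZ hZt (z_mem_h0 (by omega)) (z_mem_h0 (by omega))]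

/-- Euler's recursion for the even zeta values. -/
lemma euler_recursion (hZ : RegularizedDoubleShuffle Z) (hZt : Zt ∘ₗ (h0 K).subtype = Z)
    (r : ℕ) :
    2 * ∑ p ∈ antidiagonal r, Zt (z K (2 * p.1 + 2)) * Zt (z K (2 * p.2 + 2)) =
      (2 * r + 5) * Zt (z K (2 * r + 4)) := by
  set T : ℕ → ℕ → R := fun a b => Zt (stuffle K (z K (a + 1)) (z K (b + 1))) with hT
  have hA : ∑ p ∈ antidiagonal (2 * r + 2), (-1 : R) ^ p.1 * T p.1 p.2 =
      2 * Zt (Y K * z K (2 * r + 3)) := by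
    have h := congrArg Zt (alternating_sum_shuffle K (2 * r))
    rw [map_sum, map_smul, (even_two_mul r).neg_one_pow, add_smul, one_smul, ← two_mul] at h
    rw [← h]
    refine sum_congr rfl fun p hp => ?_
    rw [map_smul, neg_one_pow_smul, extension_shuffle_eq_stuffle hZ hZt]
    have := mem_antidiagonal.1 hp
    omega
  have hB : ∑ p ∈ antidiagonal (2 * r + 2), T p.1 p.2 =
      2 * Zt (Y K * z K (2 * r + 3)) + (2 * r + 5) * Zt (z K (2 * r + 4)) := by
    have h1 : ∑ p ∈ antidiagonal (2 * r + 2), Zt (z K (p.1 + 1) * z K (p.2 + 1)) =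
        Zt (Y K * z K (2 * r + 3)) + Zt (z K (2 * r + 4)) := by
      rw [Nat.sum_antidiagonal_succ, ← sum_extension_z_mul_z hZ hZt (2 * r + 1), zero_add, z_one]
    have h2 : ∑ p ∈ antidiagonal (2 * r + 2), Zt (z K (p.2 + 1) * z K (p.1 + 1)) =
        Zt (Y K * z K (2 * r + 3)) + Zt (z K (2 * r + 4)) := by
      rw [← h1, ← Nat.sum_antidiagonal_swap]
      rfl
    have h3 : ∑ p ∈ antidiagonal (2 * r + 2), Zt (z K (p.1 + 1 + (p.2 + 1))) =
        (2 * r + 3) * Zt (z K (2 * r + 4)) := by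
      rw [sum_congr rfl (g := fun _ => Zt (z K (2 * r + 4))) fun p hp => by
        rw [← (show p.1 + 1 + (p.2 + 1) = 2 * r + 4 by have := mem_antidiagonal.1 hp; omega)]]
      simp
      ring
    simp only [hT, stuffle_z_z (K := K) (Nat.succ_pos _) (Nat.succ_pos _), map_add, sum_add_distrib]
    rw [h1, h2, h3]
    ring
  -- Subtracting `hA` from `hB` removes the meaningless value `Zt (Y K * z K (2 * r + 3))`. Only odd
  -- `p.1` survive, that is, products of two even letters, where `Zt` is multiplicative.
  have hC : ∑ p ∈ antidiagonal (2 * r + 2), (1 - (-1 : R) ^ p.1) * T p.1 p.2 =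
      (2 * r + 5) * Zt (z K (2 * r + 4)) := by
    simp only [sub_mul, one_mul, sum_sub_distrib, hA, hB]
    ring
  rw [← hC, sum_antidiagonal_two_mul (fun a b => (1 - (-1 : R) ^ a) * T a b)]
  simp only [pow_mul, pow_succ, mul_sum]
  simp only [pow_zero, mul_neg, neg_neg, one_pow, mul_one, sub_self, zero_mul,
    sum_const_zero, zero_add]
  refine sum_congr rfl fun p _ => ?_
  rw [hT]
  simp only [add_assoc, one_add_one_eq_two]
  rw [extension_stuffle hZ hZt (z_mem_h0 (by omega)) (z_mem_h0 (by omega))]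
  ring

end Zeta

/-! ### Power series arguments: from Newton and Euler to recursions -/

section Recursions

variable {R : Type*} [CommRing R]

/-- Newton's identities and Euler's recursion determine the elementary symmetric functions. -/
lemma elementary_recursion (p e : ℕ → R)
    (hp : ∀ r : ℕ, 2 * ∑ q ∈ antidiagonal r, p q.1 * p q.2 = (2 * r + 5) * p (r + 1))
    (he : ∀ k : ℕ, (k + 1) * e (k + 1) = ∑ q ∈ antidiagonal k, (-1) ^ q.1 * (p q.1 * e q.2))
    (k : ℕ) : (2 * k + 2) * (2 * k + 3) * e (k + 1) = 6 * p 0 * e k := by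
  have hn : ∀ (m : ℕ) (f : PowerSeries R) (i : ℕ), PowerSeries.coeff i ((m : PowerSeries R) * f) =
      m * PowerSeries.coeff i f := by
    intro m f i
    rw [← map_natCast (PowerSeries.C (R := R)) m, PowerSeries.coeff_C_mul]
  have hn2 := hn 2
  have hn3 := hn 3
  push_cast at hn2 hn3
  set E : PowerSeries R := PowerSeries.mk e with hE
  set Q : PowerSeries R := PowerSeries.mk fun i => (-1) ^ i * p i with hQ
  have h1 : PowerSeries.derivative R E = Q * E := by
    ext n
    rw [PowerSeries.coeff_derivative, PowerSeries.coeff_mul, hE,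
      PowerSeries.coeff_mk, mul_comm, he]
    simp [hQ, mul_assoc]
  -- Euler's recursion as a Riccati equation for `Q`, which `h1` identifies with `E'/E`;
  -- substituting `E'' = Q' E + Q² E` makes it the linear equation `h3`.
  have h2 : 2 * PowerSeries.X * PowerSeries.derivative R Q + 2 * PowerSeries.X * Q ^ 2 + 3 * Q =
      3 * PowerSeries.C (p 0) := by
    ext n
    rcases n with _ | n
    · simp only [mul_assoc, map_add, hn2, hn3, PowerSeries.coeff_zero_X_mul]
      simp [hQ]
    · have hQ2 : 2 * PowerSeries.coeff n (Q ^ 2) = (-1) ^ n * ((2 * n + 5) * p (n + 1)) := by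
        rw [← hp, pow_two, PowerSeries.coeff_mul, mul_left_comm]
        congr 1
        rw [mul_sum]
        refine sum_congr rfl fun q hq => ?_
        rw [← mem_antidiagonal.1 hq]
        simp only [hQ, PowerSeries.coeff_mk]
        ring
      simp only [mul_assoc, map_add, hn2, hn3, PowerSeries.coeff_succ_X_mul]
      rw [hQ2, PowerSeries.coeff_derivative,
        PowerSeries.coeff_C, if_neg (by omega)]
      simp only [hQ, PowerSeries.coeff_mk]
      ring
  have h3 : 2 * (PowerSeries.X * PowerSeries.derivative R (PowerSeries.derivative R E)) +
      3 * PowerSeries.derivative R E = PowerSeries.C (3 * p 0) * E := by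
    have h4 : PowerSeries.derivative R (PowerSeries.derivative R E) =
        PowerSeries.derivative R Q * E + Q * (Q * E) := by
      rw [h1, Derivation.leibniz, h1]
      simp only [smul_eq_mul]
      ring
    rw [h4, h1, map_mul, map_ofNat]
    linear_combination E * h2
  have h5 := congrArg (PowerSeries.coeff k) h3
  rw [map_add, hn2, hn3, PowerSeries.coeff_C_mul] at h5
  rcases k with _ | k
  · rw [PowerSeries.coeff_zero_X_mul, PowerSeries.coeff_derivative] at h5
    simp only [hE, PowerSeries.coeff_mk] at h5
    push_cast at h5 ⊢
    linear_combination 2 * h5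
  · rw [PowerSeries.coeff_succ_X_mul, PowerSeries.coeff_derivative,
      PowerSeries.coeff_derivative] at h5
    simp only [hE, PowerSeries.coeff_mk] at h5
    push_cast at h5 ⊢
    linear_combination 2 * h5

lemma isUnit_alternating {e : ℕ → R} (h0 : e 0 = 1) :
    IsUnit (PowerSeries.mk fun i => (-1 : R) ^ i * e i) := by
  rw [PowerSeries.isUnit_iff_constantCoeff]
  simp [h0]

/-- The three-term recursion for the sums of even multiple zeta values of fixed depth. -/
lemma depth_recursion (e : ℕ → R) (s : ℕ → ℕ → R) (c : R) (h0 : e 0 = 1)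
    (he : ∀ k : ℕ, (2 * k + 2) * (2 * k + 3) * e (k + 1) = c * e k)
    (hs : ∀ n k : ℕ, ∑ q ∈ antidiagonal k, (-1) ^ q.1 * (e q.1 * s n q.2) =
      (-1) ^ (n + k) * (k.choose n * e k)) (n k : ℕ) :
    4 * (n + 2) * (n + 1) * s (n + 2) (k + 1) =
      2 * (2 * n + 3) * (n + 1) * s (n + 1) (k + 1) - c * s n k := by
  set φ : PowerSeries R := PowerSeries.mk fun i => (-1) ^ i * e i with hφ
  have hF : ∀ n, φ * PowerSeries.mk (s n) =
      PowerSeries.mk fun k => (-1) ^ (n + k) * (k.choose n * e k) := by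
    intro n
    ext k
    rw [PowerSeries.coeff_mul, PowerSeries.coeff_mk, ← hs]
    simp [hφ, mul_assoc]
  -- After multiplication by the unit `φ = E(-t)` all coefficients are explicit, so the claim
  -- reduces to binomial identities (`c1`, `c2`) and the recursion `he` for `e`.
  have key : φ * (PowerSeries.C (4 * (n + 2) * (n + 1) : R) * PowerSeries.mk (s (n + 2)) -
      PowerSeries.C (2 * (2 * n + 3) * (n + 1) : R) * PowerSeries.mk (s (n + 1)) +
      PowerSeries.X * (PowerSeries.C c * PowerSeries.mk (s n))) = φ * 0 := by
    have : ∀ x y w a b d : PowerSeries R, φ * (a * x - b * y + w * (d * PowerSeries.mk (s n))) =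
        a * (φ * x) - b * (φ * y) + w * (d * (φ * PowerSeries.mk (s n))) := by
      intros; ring
    rw [this, hF, hF, hF, mul_zero]
    ext i
    rcases i with _ | i
    · simp
    · simp only [map_add, map_sub, PowerSeries.coeff_C_mul, PowerSeries.coeff_succ_X_mul,
        PowerSeries.coeff_mk, map_zero]
      have c1 : ((n : R) + 1) * ((i + 1).choose (n + 1) : R) = (i + 1) * (i.choose n : R) := by
        have := congrArg (Nat.cast : ℕ → R) (Nat.add_one_mul_choose_eq i n)
        push_cast at this
        linear_combination -this
      have c2 : ((n : R) + 2) * (((i + 1).choose (n + 1) : R) + ((i + 1).choose (n + 2) : R)) =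
          (i + 2) * ((i + 1).choose (n + 1) : R) := by
        have := congrArg (Nat.cast : ℕ → R) (Nat.add_one_mul_choose_eq (i + 1) (n + 1))
        rw [Nat.choose_succ_succ (i + 1) (n + 1)] at this
        push_cast at this
        linear_combination -this
      have c3 := he i
      rw [show n + 2 + (i + 1) = n + i + 3 by ring, show n + 1 + (i + 1) = n + i + 2 by ring]
      simp only [pow_succ]
      linear_combination (-(-1) ^ (n + i) * e (i + 1)) * (4 * (n + 1) * c2 + (4 * i + 6) * c1) -
        (-1) ^ (n + i) * (i.choose n : R) * c3
  have h := congrArg (PowerSeries.coeff (k + 1)) ((isUnit_alternating h0).mul_left_cancel key)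
  simp only [map_add, map_sub, PowerSeries.coeff_C_mul, PowerSeries.coeff_succ_X_mul,
        PowerSeries.coeff_mk, map_zero] at h
  linear_combination h

end Recursions

/-! ### The rational coefficients and their recursion in the depth -/

section Coefficients

variable (K : Type*) [Field K] [CharZero K]

/-- The coefficient of `λ^{2j} ζ(2k - 2j)` in depth `n + 1`. -/
noncomputable def depthCoeff (n j : ℕ) : K :=
  ((2 * n + 1 - 2 * j).choose (n + 1) : K) / (2 ^ (2 * n) * ((2 * j + 1).factorial : K))

variable {K}

/-- The upper entry of the binomial is below `n + 1`, also when the natural subtraction truncates to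
0. -/
lemma depthCoeff_eq_zero {n j : ℕ} (h : n < 2 * j) : depthCoeff K n j = 0 := by
  rw [depthCoeff, Nat.choose_eq_zero_of_lt (by omega)]
  simp

lemma choose_succ_right_cast (m l : ℕ) :
    ((l : K) + 1) * (m.choose (l + 1) : K) = (m - l) * (m.choose l : K) := by
  have h : (m + 1) * m.choose l = (m.choose l + m.choose (l + 1)) * (l + 1) := by
    rw [Nat.add_one_mul_choose_eq, Nat.choose_succ_succ]
  have h' : ((m : K) + 1) * m.choose l = (m.choose l + m.choose (l + 1)) * (l + 1) := by
    exact_mod_cast h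
  linear_combination -h'

lemma choose_add_two_cast (m l : ℕ) :
    ((l : K) + 2) * (l + 1) * ((m + 2).choose (l + 2) : K) =
      (m + 2) * (m + 1) * (m.choose l : K) := by
  have h : ((m : K) + 1) * m.choose l = (m + 1).choose (l + 1) * (l + 1) := by
    exact_mod_cast Nat.add_one_mul_choose_eq m l
  have h' : ((m : K) + 2) * (m + 1).choose (l + 1) = (m + 2).choose (l + 2) * (l + 2) := by
    exact_mod_cast Nat.add_one_mul_choose_eq (m + 1) (l + 1)
  linear_combination (-(l : K) - 1) * h' - (m + 2) * h

lemma depthCoeff_recursion_zero (n : ℕ) :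
    4 * ((n : K) + 2) * depthCoeff K (n + 1) 0 = 2 * (2 * n + 3) * depthCoeff K n 0 := by
  have h1 := choose_add_two_cast (K := K) (2 * n + 1) n
  have h2 := choose_succ_right_cast (K := K) (2 * n + 1) n
  have hn : (n : K) + 1 ≠ 0 := by exact_mod_cast Nat.succ_ne_zero n
  rw [depthCoeff, depthCoeff, show 2 * (n + 1) + 1 - 2 * 0 = 2 * n + 1 + 2 by ring_nf; omega,
    show 2 * n + 1 - 2 * 0 = 2 * n + 1 by omega, show 2 * (n + 1) = 2 * n + 2 by ring, pow_add]
  push_cast at h1 h2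
  field_simp
  apply mul_left_cancel₀ hn
  linear_combination 4 * h1 - 8 * (2 * (n : K) + 3) * h2

/-- This matches `depth_recursion` with `n + 1` for `n`: there `c = 6ζ(2) = -λ²/4`, so the last term
contributes a quarter and raises `j` by one. -/
lemma depthCoeff_recursion (n j : ℕ) :
    4 * ((n : K) + 3) * (n + 2) * depthCoeff K (n + 2) (j + 1) =
      2 * (2 * n + 5) * (n + 2) * depthCoeff K (n + 1) (j + 1) + depthCoeff K n j / 4 := by
  rcases lt_or_ge n (2 * j) with h | h
  · rw [depthCoeff_eq_zero h, depthCoeff_eq_zero (by omega), depthCoeff_eq_zero (by omega)]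
    simp
  obtain ⟨m, hm⟩ : ∃ m, 2 * n + 1 - 2 * j = m := ⟨_, rfl⟩
  have hm' : (2 * n + 1 : K) = m + 2 * j := by
    exact_mod_cast (by omega : 2 * n + 1 = m + 2 * j)
  have h1 := choose_add_two_cast (K := K) m (n + 1)
  have h2 := choose_succ_right_cast (K := K) m (n + 1)
  have hf : ((2 * (j + 1) + 1).factorial : K) =
      (2 * j + 3) * (2 * j + 2) * ((2 * j + 1).factorial : K) := by
    rw [show 2 * (j + 1) + 1 = 2 * j + 1 + 1 + 1 by ring, Nat.factorial_succ, Nat.factorial_succ]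
    push_cast
    ring
  have hf0 : ((2 * j + 1).factorial : K) ≠ 0 := by exact_mod_cast Nat.factorial_ne_zero _
  have h3 : (2 * (j : K) + 3) ≠ 0 := by exact_mod_cast (by omega : 2 * j + 3 ≠ 0)
  have h4 : (2 * (j : K) + 2) ≠ 0 := by exact_mod_cast (by omega : 2 * j + 2 ≠ 0)
  rw [depthCoeff, depthCoeff, depthCoeff, hf, hm,
    show 2 * (n + 2) + 1 - 2 * (j + 1) = m + 2 by omega,
    show 2 * (n + 1) + 1 - 2 * (j + 1) = m by omega,
    show 2 * (n + 2) = 2 * n + 4 by ring, show 2 * (n + 1) = 2 * n + 2 by ring, pow_add, pow_add]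
  push_cast at h1 h2
  rw [show (m : K) = 2 * n + 1 - 2 * j by linear_combination -hm'] at h1 h2
  have key : 4 * ((n : K) + 3) * (n + 2) * ((m + 2).choose (n + 2 + 1) : K) =
      8 * (2 * n + 5) * (n + 2) * (m.choose (n + 1 + 1) : K) +
        4 * ((2 * j + 3) * (2 * j + 2)) * (m.choose (n + 1) : K) := by
    linear_combination 4 * h1 - 8 * (2 * (n : K) + 5) * h2
  rw [← mul_div_assoc, ← mul_div_assoc, key]
  field_simp
  ring

end Coefficients

/-! ### Bernoulli numbers of even index -/

section Bernoulli

lemma sum_range_two_mul {M : Type*} [AddCommMonoid M] (f : ℕ → M) (n : ℕ) :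
    ∑ i ∈ range (2 * n), f i = ∑ j ∈ range n, f (2 * j) + ∑ j ∈ range n, f (2 * j + 1) := by
  induction n with
  | zero => simp
  | succ n ih =>
    rw [show 2 * (n + 1) = 2 * n + 1 + 1 by ring, sum_range_succ, sum_range_succ, ih,
      sum_range_succ _ n, sum_range_succ _ n]
    abel

/-- Otherwise Euler's formula for the real zeta value would make a sum of nonnegative terms
containing `1` equal to zero. -/
lemma bernoulli_two_mul_ne_zero {j : ℕ} (hj : j ≠ 0) : bernoulli (2 * j) ≠ 0 := by
  intro h
  have h1 := hasSum_zeta_nat hj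
  rw [h] at h1
  have h2 : (0 : ℝ) < 0 := by
    have h3 := h1.summable.sum_le_tsum {1} (fun i _ => by positivity)
    rw [h1.tsum_eq] at h3
    norm_num at h3
  exact lt_irrefl _ h2

/-- The vanishing of `B_{2k+3}(1/2)`, in terms of Bernoulli numbers. -/
lemma sum_choose_mul_bernoulli_even (k : ℕ) :
    ∑ j ∈ range (k + 1), 4 ^ (j + 1) * ((2 * k + 3).choose (2 * j + 2) : ℚ) *
      bernoulli (2 * j + 2) = 2 * k + 2 := by
  have h : (Polynomial.bernoulli (2 * k + 3)).eval (1 / 2 : ℚ) = 0 := by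
    have h := Polynomial.bernoulli_eval_one_sub (2 * k + 3) (1 / 2)
    rw [Odd.neg_one_pow ⟨k + 1, by ring⟩] at h
    norm_num at h ⊢
    linarith
  have h1 : ∑ i ∈ range (2 * (k + 2)), 2 ^ i * ((2 * k + 3).choose i : ℚ) * bernoulli i = 0 := by
    rw [Polynomial.bernoulli, Polynomial.eval_finsetSum] at h
    rw [← mul_zero (2 ^ (2 * k + 3) : ℚ), ← h, mul_sum]
    refine sum_congr rfl fun i hi => ?_
    have hi' : i + (2 * k + 3 - i) = 2 * k + 3 := by have := mem_range.1 hi; omega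
    have hp : (2 : ℚ) ^ (2 * k + 3) = 2 ^ i * 2 ^ (2 * k + 3 - i) := by rw [← pow_add, hi']
    rw [Polynomial.eval_monomial, hp, one_div, inv_pow]
    field_simp
  -- The terms `i = 0` and `i = 1` contribute `1 - (2k + 3)`, which is the right-hand side with
  -- opposite sign; the other odd Bernoulli numbers vanish.
  rw [sum_range_two_mul, sum_range_succ', sum_range_succ' (fun j => 2 ^ (2 * j + 1) * _ * _),
    sum_eq_zero (f := fun j => 2 ^ (2 * (j + 1) + 1) * _ * _) fun j _ => by
      rw [bernoulli_eq_zero_of_odd ⟨j + 1, rfl⟩ (by omega), mul_zero]] at h1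
  simp only [pow_mul] at h1
  norm_num at h1
  simp only [mul_add, mul_one] at h1
  linarith

variable (K : Type*) [Field K] [CharZero K]

/-- Coefficient form of `sinh(u/2)/(u/2) · ((u/2) coth(u/2) - 1) = cosh(u/2) - sinh(u/2)/(u/2)`. -/
lemma sum_antidiagonal_bernoulli (k : ℕ) :
    ∑ p ∈ antidiagonal k, ((bernoulli (2 * p.2 + 2) : ℚ) : K) /
        (4 ^ p.1 * ((2 * p.1 + 1).factorial : K) * ((2 * p.2 + 2).factorial : K)) =
      2 * (k + 1) / (4 ^ (k + 1) * ((2 * k + 3).factorial : K)) := by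
  have h := congrArg (Rat.cast : ℚ → K) (sum_choose_mul_bernoulli_even k)
  push_cast at h
  rw [← Nat.sum_antidiagonal_swap, show (2 : K) * (k + 1) = 2 * k + 2 by ring, ← h,
    ← Nat.sum_antidiagonal_eq_sum_range_succ (fun j _ => (4 : K) ^ (j + 1) *
      ((2 * k + 3).choose (2 * j + 2) : K) * ((bernoulli (2 * j + 2) : ℚ) : K)) k, sum_div]
  refine sum_congr rfl fun p hp => ?_
  rw [Prod.fst_swap, Prod.snd_swap, ← HasAntidiagonal.mem_antidiagonal.1 hp,
    show 2 * (p.1 + p.2) + 3 = 2 * p.1 + 2 + (2 * p.2 + 1) by ring, Nat.cast_add_choose,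
    show p.1 + p.2 + 1 = p.1 + 1 + p.2 by ring, pow_add _ (p.1 + 1)]
  have h1 : ((2 * p.1 + 2 + (2 * p.2 + 1)).factorial : K) ≠ 0 := by
    exact_mod_cast Nat.factorial_ne_zero _
  field_simp

end Bernoulli

/-! ### Sums over compositions, and the word identities under `Zt` -/

section Compositions

lemma sum_compositions_succ {M : Type*} [AddCommMonoid M] (n k : ℕ)
    (F : (Fin (n + 1) → ℕ) → M) :
    ∑ κ ∈ compositions (n + 1) (k + 1), F κ =
      ∑ p ∈ antidiagonal k, ∑ κ ∈ compositions n p.2, F (Fin.cons (p.1 + 1) κ) := by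
  rw [sum_sigma']
  symm
  refine sum_bij' (fun x _ => Fin.cons (x.1.1 + 1) x.2)
    (fun κ _ => ⟨(κ 0 - 1, k + 1 - κ 0), Fin.tail κ⟩) ?_ ?_ ?_ ?_ ?_
  · rintro ⟨⟨a, b⟩, κ⟩ h
    simp only [compositions, mem_sigma, HasAntidiagonal.mem_antidiagonal, mem_filter,
      Nat.mem_antidiagonalTuple] at h ⊢
    refine ⟨?_, fun i => ?_⟩
    · rw [Fin.sum_univ_succ]
      simp only [Fin.cons_zero, Fin.cons_succ]
      omega
    · refine Fin.cases ?_ (fun i => ?_) i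
      · simp
      · simpa using h.2.2 i
  · intro κ h
    simp only [compositions, mem_sigma, HasAntidiagonal.mem_antidiagonal, mem_filter,
      Nat.mem_antidiagonalTuple] at h ⊢
    obtain ⟨h1, h2⟩ := h
    rw [Fin.sum_univ_succ] at h1
    have h0 := h2 0
    refine ⟨by omega, ?_, fun i => h2 i.succ⟩
    simp only [Fin.tail]
    omega
  · rintro ⟨⟨a, b⟩, κ⟩ h
    simp only [mem_sigma, HasAntidiagonal.mem_antidiagonal] at h
    obtain rfl : k = a + b := h.1.symm
    have : a + b + 1 - (a + 1) = b := by omega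
    simp [this]
  · intro κ h
    simp only [compositions, mem_filter] at h
    have h0 := h.2 0
    simp only
    rw [Nat.sub_add_cancel h0, Fin.cons_self_tail]
  · intros
    rfl

variable {K : Type*} [Field K]

lemma evenSum_eq_sum (n k : ℕ) :
    evenSum K n k = ∑ κ ∈ compositions n k, zWord K (List.ofFn fun i => 2 * κ i) := by
  induction n generalizing k with
  | zero =>
    cases k with
    | zero => simp [evenSum, compositions, zWord]
    | succ k => simp [evenSum, compositions]
  | succ n ih =>
    cases k with
    | zero =>
      rw [evenSum, compositions, sum_eq_zero]
      intro κ hκ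
      rw [mem_filter, Nat.mem_antidiagonalTuple, Fin.sum_univ_succ] at hκ
      have := hκ.2 0
      omega
    | succ k =>
      rw [evenSum, evenCons, sum_compositions_succ]
      refine sum_congr rfl fun p _ => ?_
      rw [ih, mul_sum]
      refine sum_congr rfl fun κ _ => ?_
      rw [List.ofFn_succ, zWord_cons]
      simp [mul_add]

lemma admissible_of_mem_compositions {n k : ℕ} {κ : Fin n → ℕ} (h : κ ∈ compositions n k) :
    Admissible (List.ofFn fun i => 2 * κ i) := by
  rw [compositions, mem_filter] at h
  have h2 : ∀ a ∈ List.ofFn fun i => 2 * κ i, 2 ≤ a := by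
    intro a ha
    obtain ⟨i, rfl⟩ := (List.mem_ofFn' _ _).1 ha
    have := h.2 i
    simp only
    omega
  exact ⟨fun a ha => le_trans (by norm_num) (h2 a ha),
    fun a ha => h2 a (List.mem_of_mem_head? ha)⟩

lemma evenSum_mem_h0 (n k : ℕ) : evenSum K n k ∈ h0 K := by
  rw [evenSum_eq_sum]
  exact Submodule.sum_mem _ fun κ hκ => zWord_mem_h0 K _ (admissible_of_mem_compositions hκ)

lemma z_two_pow_mem_h0 (i : ℕ) : z K 2 ^ i ∈ h0 K := by
  rcases i with _ | i
  · simpa using one_mem_h0 K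
  · rw [pow_succ']
    refine z_mul_mem_h0 K 2 le_rfl _ ?_
    induction i with
    | zero => simpa using one_mem_h1 K
    | succ i ih => rw [pow_succ']; exact z_mul_mem_h1 K 2 _ ih

variable {R : Type*} [CommRing R] [Algebra K R] {Z : h0 K →ₗ[K] R} {Zt : H K →ₗ[K] R}

lemma extension_evenSum (hZt : Zt ∘ₗ (h0 K).subtype = Z) (n k : ℕ) :
    Zt (evenSum K n k) = ∑ κ ∈ compositions n k, zeta Z (List.ofFn fun i => 2 * κ i) := by
  rw [evenSum_eq_sum, map_sum]
  exact sum_congr rfl fun κ hκ => extension_zWord hZt (admissible_of_mem_compositions hκ)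

lemma extension_evenSum_one (k : ℕ) : Zt (evenSum K 1 (k + 1)) = Zt (z K (2 * k + 2)) := by
  rcases k with _ | k
  · simp [evenSum, evenCons]
  · rw [evenSum, evenCons, Nat.sum_antidiagonal_succ', sum_eq_zero fun p _ => by simp [evenSum]]
    simp [evenSum]

variable [CharZero K]

lemma extension_z_two_pow_succ (hZ : RegularizedDoubleShuffle Z)
    (hZt : Zt ∘ₗ (h0 K).subtype = Z) (k : ℕ) :
    (2 * k + 2) * (2 * k + 3) * Zt (z K 2 ^ (k + 1)) = 6 * zeta Z [2] * Zt (z K 2 ^ k) := by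
  have h := elementary_recursion (fun i => Zt (z K (2 * i + 2))) (fun i => Zt (z K 2 ^ i))
    (fun r => euler_recursion hZ hZt r) (fun k => ?_) k
  · simpa [extension_z hZt (le_refl 2)] using h
  · have h := congrArg Zt (newton_z_two_pow (K := K) k)
    rw [map_sum, map_smul] at h
    simp only [map_smul, neg_one_pow_smul] at h
    rw [show ((k : K) + 1) • Zt (z K 2 ^ (k + 1)) = ((k : R) + 1) * Zt (z K 2 ^ (k + 1)) by
      rw [Algebra.smul_def]; simp] at h
    rw [← h]
    refine sum_congr rfl fun p _ => ?_
    rw [extension_stuffle hZ hZt (z_mem_h0 (by omega)) (z_two_pow_mem_h0 _)]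

lemma sum_extension_evenSum (hZ : RegularizedDoubleShuffle Z)
    (hZt : Zt ∘ₗ (h0 K).subtype = Z) (n k : ℕ) :
    ∑ q ∈ antidiagonal k, (-1) ^ q.1 * (Zt (z K 2 ^ q.1) * Zt (evenSum K n q.2)) =
      (-1) ^ (n + k) * (k.choose n * Zt (z K 2 ^ k)) := by
  have h := congrArg Zt (evenConv_eq (K := K) n k)
  rw [evenConv, map_sum, map_smul, Algebra.smul_def] at h
  simp only [map_smul, neg_one_pow_smul] at h
  simp only [map_mul, map_pow, map_neg, map_one, map_natCast] at h
  rw [← mul_assoc, ← h]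
  refine sum_congr rfl fun p _ => ?_
  rw [extension_stuffle hZ hZt (z_two_pow_mem_h0 _) (evenSum_mem_h0 _ _)]

lemma extension_z_two_pow_zero (hZ : RegularizedDoubleShuffle Z)
    (hZt : Zt ∘ₗ (h0 K).subtype = Z) : Zt (z K 2 ^ 0) = 1 := by
  rw [pow_zero, extension_one hZ hZt]

end Compositions

/-! ### The depth induction, Euler's formula and the comparison of the two forms -/

section Main

variable {K : Type*} [Field K] [CharZero K] {R : Type*} [CommRing R] [Algebra K R]
  {Z : h0 K →ₗ[K] R} {Zt : H K →ₗ[K] R}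

lemma sum_depthCoeff_zero {n : ℕ} (hn : n < 2) (d : R) (p : ℕ → R) (k : ℕ) :
    ∑ q ∈ antidiagonal k, algebraMap K R (depthCoeff K n q.1) * (d ^ q.1 * p q.2) =
      algebraMap K R (depthCoeff K n 0) * p k := by
  rcases k with _ | k
  · simp
  · rw [Nat.sum_antidiagonal_succ, sum_eq_zero fun q _ => by
      rw [depthCoeff_eq_zero (by omega), map_zero, zero_mul]]
    simp

/-- Two-step induction on the depth, both sides obeying the same recursion. The bound `n ≤ k`
matters: in depth 2 with `k = 0` the left side is an empty sum while the right side is `(3/4) ζ(2)`.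
-/
lemma extension_evenSum_eq_antidiagonal (hZ : RegularizedDoubleShuffle Z)
    (hZt : Zt ∘ₗ (h0 K).subtype = Z) (n k : ℕ) (hnk : n ≤ k) :
    Zt (evenSum K (n + 1) (k + 1)) = ∑ q ∈ antidiagonal k,
      algebraMap K R (depthCoeff K n q.1) * ((-24 * zeta Z [2]) ^ q.1 *
        Zt (z K (2 * q.2 + 2))) := by
  have hrec := depth_recursion (fun k => Zt (z K 2 ^ k)) (fun n k => Zt (evenSum K n k))
    (6 * zeta Z [2]) (extension_z_two_pow_zero hZ hZt) (extension_z_two_pow_succ hZ hZt)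
    (sum_extension_evenSum hZ hZt)
  -- `R` may have zero divisors, but nonzero integers come from units of `K`.
  have hunit : ∀ m : ℕ, m ≠ 0 → IsUnit ((m : ℕ) : R) := by
    intro m hm
    rw [← map_natCast (algebraMap K R)]
    exact (IsUnit.mk0 _ (Nat.cast_ne_zero.2 hm)).map _
  have hd0 : depthCoeff K 0 0 = 1 := by simp [depthCoeff]
  induction n using Nat.twoStepInduction generalizing k with
  | zero =>
    rw [sum_depthCoeff_zero (by norm_num) _ fun i => Zt (z K (2 * i + 2)),
      extension_evenSum_one, hd0, map_one, one_mul]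
  | one =>
    obtain ⟨k, rfl⟩ : ∃ l, k = l + 1 := ⟨k - 1, by omega⟩
    rw [sum_depthCoeff_zero (by norm_num) _ fun i => Zt (z K (2 * i + 2))]
    have h := hrec 0 (k + 1)
    have hc := congrArg (algebraMap K R) (depthCoeff_recursion_zero (K := K) 0)
    simp only [map_mul, map_add, map_ofNat, Nat.cast_zero, map_zero, hd0, map_one] at hc
    rw [show evenSum K 0 (k + 1) = 0 from rfl, map_zero, zero_add,
      extension_evenSum_one] at h
    apply (hunit 8 (by norm_num)).mul_left_cancel
    push_cast at h ⊢
    linear_combination h - Zt (z K (2 * (k + 1) + 2)) * hc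
  | more n ih1 ih2 =>
    obtain ⟨k, rfl⟩ : ∃ l, k = l + 1 := ⟨k - 1, by omega⟩
    have h := hrec (n + 1) (k + 1)
    rw [ih2 (k + 1) (by omega), ih1 k (by omega)] at h
    apply (hunit (4 * (n + 3) * (n + 2)) (by positivity)).mul_left_cancel
    have hc0 := congrArg (algebraMap K R) (depthCoeff_recursion_zero (K := K) (n + 1))
    have hc := fun j => congrArg (algebraMap K R) (depthCoeff_recursion (K := K) n j)
    simp only [map_mul, map_add, map_ofNat, map_natCast, map_one, Nat.cast_add, Nat.cast_one] at hc0 hc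
    have hsum : 4 * ((n : R) + 3) * (n + 2) * ∑ q ∈ antidiagonal k,
        algebraMap K R (depthCoeff K (n + 2) (q.1 + 1)) *
          ((-24 * zeta Z [2]) ^ (q.1 + 1) * Zt (z K (2 * q.2 + 2))) =
        2 * (2 * n + 5) * (n + 2) * ∑ q ∈ antidiagonal k,
        algebraMap K R (depthCoeff K (n + 1) (q.1 + 1)) *
          ((-24 * zeta Z [2]) ^ (q.1 + 1) * Zt (z K (2 * q.2 + 2))) -
        6 * zeta Z [2] * ∑ q ∈ antidiagonal k,
        algebraMap K R (depthCoeff K n q.1) *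
          ((-24 * zeta Z [2]) ^ q.1 * Zt (z K (2 * q.2 + 2))) := by
      simp only [mul_sum, ← sum_sub_distrib]
      refine sum_congr rfl fun q _ => ?_
      have h4 : algebraMap K R (depthCoeff K n q.1 / 4) * 4 = algebraMap K R (depthCoeff K n q.1) := by
        rw [← map_ofNat (algebraMap K R) 4, ← map_mul]
        congr 1
        field_simp
      rw [← h4]
      linear_combination (-24 * zeta Z [2]) ^ (q.1 + 1) * Zt (z K (2 * q.2 + 2)) * hc q.1
    rw [Nat.sum_antidiagonal_succ] at h ⊢
    push_cast at h ⊢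
    linear_combination h - hsum - (n + 2) * Zt (z K (2 * (k + 1) + 2)) * hc0

lemma compositions_sum_eq (hZ : RegularizedDoubleShuffle Z) {k n : ℕ} (hn : 1 ≤ n)
    (hnk : n ≤ k) :
    ∑ κ ∈ compositions n k, zeta Z (List.ofFn fun i => 2 * κ i) =
      ∑ j ∈ range ((n - 1) / 2 + 1),
        (((2 * n - 2 * j - 1).choose n : K) / (2 ^ (2 * n - 2) * ((2 * j + 1).factorial : K))) •
          ((-24 * zeta Z [2]) ^ j * zeta Z [2 * k - 2 * j]) := by
  obtain ⟨Zt, hZt⟩ := Z.exists_extend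
  obtain ⟨n, rfl⟩ : ∃ l, n = l + 1 := ⟨n - 1, by omega⟩
  obtain ⟨k, rfl⟩ : ∃ l, k = l + 1 := ⟨k - 1, by omega⟩
  rw [← extension_evenSum hZt, extension_evenSum_eq_antidiagonal hZ hZt n k (by omega),
    Nat.sum_antidiagonal_eq_sum_range_succ fun i j => algebraMap K R (depthCoeff K n i) *
      ((-24 * zeta Z [2]) ^ i * Zt (z K (2 * j + 2))), Nat.add_sub_cancel]
  symm
  -- The sum up to `k` may be cut at half the depth, since the later coefficients vanish.
  refine sum_subset_zero_on_sdiff (range_subset_range.2 (by omega)) ?_ ?_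
  · intro j hj
    rw [mem_sdiff, mem_range, mem_range] at hj
    rw [depthCoeff_eq_zero (by omega), map_zero, zero_mul]
  · intro j hj
    rw [mem_range] at hj
    rw [extension_z hZt (by omega), Algebra.smul_def, depthCoeff,
      show 2 * (n + 1) - 2 * j - 1 = 2 * n + 1 - 2 * j by omega,
      show 2 * (n + 1) - 2 = 2 * n by omega,
      show 2 * (k + 1) - 2 * j = 2 * (k - j) + 2 by omega]

/-- Euler's formula for the even zeta values. -/
lemma zeta_two_mul (hZ : RegularizedDoubleShuffle Z) {j : ℕ} (hj : 1 ≤ j) :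
    zeta Z [2 * j] = -((((bernoulli (2 * j) : ℚ) : K) / (2 * ((2 * j).factorial : K))) •
      (-24 * zeta Z [2]) ^ j) := by
  obtain ⟨Zt, hZt⟩ := Z.exists_extend
  set d : R := -24 * zeta Z [2] with hd
  set e : ℕ → R := fun k => Zt (z K 2 ^ k) with he
  have he0 : e 0 = 1 := extension_z_two_pow_zero hZ hZt
  -- With `d = λ²` this says `E(-t) = sinh(u/2)/(u/2)` for `u² = d t`, the analogue of the product
  -- formula for the sine.
  have heq : ∀ k, (-1) ^ k * e k = algebraMap K R (1 / (4 ^ k * ((2 * k + 1).factorial : K))) *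
      d ^ k := by
    intro k
    induction k with
    | zero => simp [he0]
    | succ k ih =>
      have h1 := extension_z_two_pow_succ hZ hZt k
      have hu : IsUnit (algebraMap K R ((2 * k + 2) * (2 * k + 3))) := by
        refine (IsUnit.mk0 _ ?_).map _
        exact_mod_cast (by positivity : (2 * k + 2) * (2 * k + 3) ≠ 0)
      have h2 : algebraMap K R ((2 * k + 2) * (2 * k + 3)) *
          algebraMap K R (1 / (4 ^ (k + 1) * ((2 * (k + 1) + 1).factorial : K))) * 4 =
          algebraMap K R (1 / (4 ^ k * ((2 * k + 1).factorial : K))) := by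
        rw [← map_ofNat (algebraMap K R) 4, ← map_mul, ← map_mul]
        congr 1
        have h3 : (2 * (k : K) + 3) ≠ 0 := by exact_mod_cast (by omega : 2 * k + 3 ≠ 0)
        have h4 : (2 * (k : K) + 2) ≠ 0 := by exact_mod_cast (by omega : 2 * k + 2 ≠ 0)
        have hf : ((2 * (k + 1) + 1).factorial : K) =
            (2 * k + 3) * (2 * k + 2) * ((2 * k + 1).factorial : K) := by
          rw [show 2 * (k + 1) + 1 = 2 * k + 1 + 1 + 1 by ring, Nat.factorial_succ,
            Nat.factorial_succ]
          push_cast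
          ring
        have hf0 : ((2 * k + 1).factorial : K) ≠ 0 := by exact_mod_cast Nat.factorial_ne_zero _
        rw [hf, pow_succ]
        field_simp
      apply hu.mul_left_cancel
      have h5 : algebraMap K R ((2 * k + 2) * (2 * k + 3)) = (2 * k + 2) * (2 * k + 3) := by
        simp only [map_mul, map_add, map_ofNat, map_natCast]
      rw [← h2, h5] at ih
      rw [h5]
      simp only [he] at ih ⊢
      rw [pow_succ (-1 : R), pow_succ d]
      have hd' : 6 * zeta Z [2] * 4 = -d := by rw [hd]; ring
      have hu4 : IsUnit (4 : R) := by
        rw [← map_ofNat (algebraMap K R) 4]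
        exact (IsUnit.mk0 _ (by norm_num)).map _
      apply hu4.mul_left_cancel
      linear_combination (-4 * (-1) ^ k) * h1 + d * ih - (-1) ^ k * Zt (z K 2 ^ k) * hd'
  set φ : PowerSeries R := PowerSeries.mk fun i => (-1) ^ i * e i with hφ
  -- On the left the product is the case of depth 1 of `sum_extension_evenSum`, on the right it is
  -- `sum_antidiagonal_bernoulli`; the unit `φ` then cancels.
  have key : φ * PowerSeries.mk (fun i => Zt (z K (2 * i + 2))) =
      φ * PowerSeries.mk (fun i => -((((bernoulli (2 * i + 2) : ℚ) : K) /
        (2 * ((2 * i + 2).factorial : K))) • d ^ (i + 1))) := by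
    ext k
    have h1 : PowerSeries.coeff k (φ * PowerSeries.mk (fun i => Zt (z K (2 * i + 2)))) =
        -((k + 1) * ((-1) ^ (k + 1) * e (k + 1))) := by
      have h := sum_extension_evenSum hZ hZt 1 (k + 1)
      rw [Nat.sum_antidiagonal_succ'] at h
      simp only [extension_evenSum_one, show evenSum K 1 0 = 0 from rfl, map_zero, mul_zero,
        zero_add] at h
      rw [PowerSeries.coeff_mul]
      simp only [hφ, PowerSeries.coeff_mk, mul_assoc, he]
      rw [h]
      simp only [Nat.choose_one_right]
      push_cast
      ring
    rw [h1, heq, PowerSeries.coeff_mul]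
    simp only [hφ, PowerSeries.coeff_mk, heq]
    have h2 := congrArg (fun x => algebraMap K R (x / 2) * d ^ (k + 1))
      (sum_antidiagonal_bernoulli K k)
    simp only [sum_div, map_sum, sum_mul] at h2
    have h3 : ((k : R) + 1) * (algebraMap K R (1 / (4 ^ (k + 1) * ((2 * (k + 1) + 1).factorial : K))) *
        d ^ (k + 1)) = algebraMap K R (2 * (k + 1) / (4 ^ (k + 1) * ((2 * k + 3).factorial : K)) / 2) *
        d ^ (k + 1) := by
      rw [← mul_assoc, show ((k : R) + 1) = algebraMap K R (k + 1) by simp, ← map_mul,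
        show 2 * (k + 1) + 1 = 2 * k + 3 by ring]
      congr 2
      field_simp
    rw [h3, ← h2, ← sum_neg_distrib]
    refine sum_congr rfl fun q hq => ?_
    rw [Algebra.smul_def, ← HasAntidiagonal.mem_antidiagonal.1 hq, mul_neg, mul_mul_mul_comm,
      ← map_mul, ← pow_add, ← add_assoc]
    congr 3
    field_simp
  obtain ⟨i, rfl⟩ : ∃ i, j = i + 1 := ⟨j - 1, by omega⟩
  have h := congrArg (PowerSeries.coeff i) ((isUnit_alternating he0).mul_left_cancel key)
  rw [PowerSeries.coeff_mk, PowerSeries.coeff_mk, extension_z hZt (by omega)] at h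
  exact h

lemma depth_term_eq (hZ : RegularizedDoubleShuffle Z) {n j : ℕ} (hj : 1 ≤ j)
    (hn : 3 ≤ n) (x : R) (a : K) :
    (a / (2 ^ (2 * n - 2) * ((2 * j + 1).factorial : K))) • ((-24 * zeta Z [2]) ^ j * x) =
      -((a / (2 ^ (2 * n - 3) * (2 * (j : K) + 1) * ((bernoulli (2 * j) : ℚ) : K))) •
        (zeta Z [2 * j] * x)) := by
  have hB : ((bernoulli (2 * j) : ℚ) : K) ≠ 0 :=
    Rat.cast_ne_zero.2 (bernoulli_two_mul_ne_zero (by omega))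
  have hf0 : ((2 * j).factorial : K) ≠ 0 := by exact_mod_cast Nat.factorial_ne_zero _
  have h1 : (2 * (j : K) + 1) ≠ 0 := by exact_mod_cast (by omega : 2 * j + 1 ≠ 0)
  rw [zeta_two_mul hZ hj, neg_mul (_ • _), smul_neg, neg_neg, smul_mul_assoc, smul_smul,
    Nat.factorial_succ, show 2 * n - 2 = 2 * n - 3 + 1 by omega, pow_succ]
  congr 1
  push_cast
  field_simp

end Main

end DoubleShuffle


theorem mainTheorem10 {K : Type*} [Field K] [CharZero K] {R : Type*} [CommRing R] [Algebra K R]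
    (Z : DoubleShuffle.h0 K →ₗ[K] R) (hZ : DoubleShuffle.RegularizedDoubleShuffle Z)
    (k n : ℕ) (hn : 1 ≤ n) (hnk : n ≤ k) :
    (∀ (L : Type*) [CommRing L] [Algebra R L] (lam : L),
      lam ^ 2 = algebraMap R L (-24 * DoubleShuffle.zeta Z [2]) →
      algebraMap R L (∑ κ ∈ DoubleShuffle.compositions n k,
          DoubleShuffle.zeta Z (List.ofFn fun i => 2 * κ i)) =
        ∑ j ∈ Finset.range ((n - 1) / 2 + 1),
          lam ^ (2 * j) * algebraMap R L
            ((((2 * n - 2 * j - 1).choose n : K) / (2 ^ (2 * n - 2) * ((2 * j + 1).factorial : K))) •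
              DoubleShuffle.zeta Z [2 * k - 2 * j])) ∧
    (∑ κ ∈ DoubleShuffle.compositions n k,
        DoubleShuffle.zeta Z (List.ofFn fun i => 2 * κ i)) =
      (((2 * n - 1).choose n : K) / 2 ^ (2 * n - 2)) • DoubleShuffle.zeta Z [2 * k] -
        ∑ j ∈ Finset.Icc 1 ((n - 1) / 2),
          (((2 * n - 2 * j - 1).choose n : K) /
              (2 ^ (2 * n - 3) * (2 * (j : K) + 1) * ((bernoulli (2 * j) : ℚ) : K))) •
            (DoubleShuffle.zeta Z [2 * j] * DoubleShuffle.zeta Z [2 * k - 2 * j]) := by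
  refine ⟨fun L _ _ lam hlam => ?_, ?_⟩
  · rw [DoubleShuffle.compositions_sum_eq hZ hn hnk, map_sum]
    refine Finset.sum_congr rfl fun j _ => ?_
    rw [pow_mul, hlam, ← map_pow, ← map_mul, mul_smul_comm]
  · rw [DoubleShuffle.compositions_sum_eq hZ hn hnk, Finset.sum_range_succ', add_comm, sub_eq_add_neg,
      ← Finset.sum_neg_distrib]
    congr 1
    · simp
    · rw [show Finset.Icc 1 ((n - 1) / 2) = Finset.Ico (0 + 1) ((n - 1) / 2 + 1) from rfl,
        ← Finset.sum_Ico_add', Finset.range_eq_Ico]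
      refine Finset.sum_congr rfl fun j hj => ?_
      rw [Finset.mem_Ico] at hj
      -- A nonempty range of `j` forces `n ≥ 3`, so the exponent `2n - 3` is not truncated.
      exact DoubleShuffle.depth_term_eq hZ (by omega) (by omega) _ _
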